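/- **Theorem (energy–dissipation relation).** *Data.* Let $g,\mu,\sigma,\beta>0$ and $\gamma_{sv},\gamma_{sf}\in\mathbb R$, put $[\![\gamma]\!]=\gamma_{sv}-\gamma_{sf}$ and assume $|[\![\gamma]\!]|/\sigma<1$. Let $\mathcal W:\mathbb R\to\mathbb R$ be a $C^2$ strictly increasing diffeomorphism with $\mathcal W(0)=0$, and let $\theta_1,\theta_2\in[0,\pi/2)$ (the sessile drop is $\theta_1=\theta_2=0$). Write $e_r=(\cos\theta,\sin\theta)$, $e_\phi=(-\sin\theta,\cos\theta)$ and $'=\partial_\theta$. For a positive function $\rho(t,\cdot)$ on $[\theta_2,\pi-\theta_1]$ let $$\Omega(t)=\{r e_r:\theta_2<\theta<\pi-\theta_1,\ 0<r<\rho(t,\theta)\},\qquad \Sigma(t)=\{\rho(t,\theta)e_r : \theta_2\le\theta\le\pi-\theta_1\},$$ and let $\Sigma_s(t)$ be the union of the two wall segments $\{r e_r: 0<r<\rho(t,\theta)\}$, $\theta\in\{\theta_2,\pi-\theta_1\}$. Let $\nu$ be the outward unit normal, $\tau=e_r$ the unit tangent on $\Sigma_s(t)$, $\mathcal N=\rho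 e_r-\rho' e_\phi$ (so $\nu=\mathcal N/|\mathcal N|$ on $\Sigma(t)$), $\mathbb Du=Du+(Du)^T$, $S(P,u)=PI-\mu\mathbb Du$, and $$\mathcal H(\rho)=\frac1\rho\Big(-\frac{\rho}{\sqrt{\rho^2+\rho'^2}}+\partial_\theta\frac{\rho'}{\sqrt{\rho^2+\rho'^2}}\Big).$$ *System.* Let $J\subset\mathbb R$ be an open set of times and let $(\rho,u,P)$ be a classical solution, for $t\in J$, of $$\begin{cases} \partial_tu+u\cdot\nabla u+\operatorname{div}S(P,u)=0,\quad \operatorname{div}u=0 & \text{in }\Omega(t),\\ S(P,u)\nu=(g\rho\sin\theta-\sigma\mathcal H(\rho))\nu & \text{on }\Sigma(t),\ \theta_2<\theta<\pi-\theta_1,\\ \partial_t\rho=\frac1\rho\,u\cdot\mathcal N & \text{on }\Sigma(t),\\ (S(P,u)\nu-\beta u)\cdot\tau=0,\quad u\cdot\nu=0 & \text{on }\Sigma_s(t),\\ \mathcal W(\partial_t\rho)=[\![\gamma]\!]-\sigma\frac{\rho'}{\sqrt{\rho^2+\rho'^2}} & \text{at }\theta=\pi-\theta_1,\\ \mathcal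 W(\partial_t\rho)=[\![\gamma]\!]+\sigma\frac{\rho'}{\sqrt{\rho^2+\rho'^2}} & \text{at }\theta=\theta_2 . \end{cases}$$ Classical means the following. The functions $\rho,\rho',\partial_t\rho,\partial_t\rho'$ exist and are continuous on $J\times[\theta_2,\pi-\theta_1]$, and $\rho(t,\cdot)$ is $C^2$ in the open interval. The velocity $u$ is continuous on $\{(t,x):t\in J,\ x\in\overline{\Omega(t)}\}$, $C^1$ in $(t,x)$ for $x\in\Omega(t)$, and $C^2$ in $x\in\Omega(t)$; $P(t,\cdot)$ is $C^1$ in $\Omega(t)$. For each $t$, $u(t,\cdot)$ is differentiable relative to $\overline{\Omega(t)}$, and $Du$ and $P$ are continuous, on $\overline{\Omega(t)}$ except possibly at the pole $0$ and the two contact points. For $x\in\Omega(t)$, and locally uniformly in $t$, $|Du|+|\partial_tu|+|P|\le C\,d^{\,l-1}$ for some $C$ and some $l>0$, where $d$ is the distance from $x$ to these three points. *Conclusion.* Let $$\mathcal F(\rho)=\frac g3\int_{\theta_2}^{\pi-\theta_1}\rho^3\sin\theta\,d\theta+\sigma\int_{\theta_2}^{\pi-\theta_1}\sqrt{\rho^2+\rho'^2}\,d\theta-[\![\gamma]\!]\big(\rho(\pi-\theta_1)+\rho(\theta_2)\big),$$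 and let $L(t)=\rho(t,\pi-\theta_1)$ and $R(t)=\rho(t,\theta_2)$ be the distances of the left and the right contact point from the pole, measured along the walls. Then for every $t\in J$ the functions $|u|^2$ and $|\mathbb Du|^2$ are integrable on $\Omega(t)$, the energy $\int_{\Omega(t)}\frac12|u|^2+\mathcal F(\rho)$ is differentiable at $t$, and $$\frac{d}{dt}\Big(\int_{\Omega(t)}\tfrac12|u|^2+\mathcal F(\rho)\Big)+\int_{\Omega(t)}\frac\mu2|\mathbb Du|^2+\int_{\Sigma_s(t)}\beta|u|^2+\partial_tL\,\mathcal W(\partial_tL)+\partial_tR\,\mathcal W(\partial_tR)=0 .$$ -/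

import Mathlib

open Real Set Filter Topology MeasureTheory

noncomputable section

namespace Droplet

/-- The Euclidean plane. -/
abbrev Plane : Type := EuclideanSpace ℝ (Fin 2)

/-! ### Physical data -/

/-- The physical data: gravity `g`, viscosity `visc`, surface tension `σ`, inverse slip length `β`,
the solid-vapor and solid-fluid free energies per unit length, the inclination angles of the two
walls, and the contact-point response function `W`. -/
structure Params where
  g : ℝ
  visc : ℝ
  σ : ℝ
  β : ℝ
  γsv : ℝ
  γsf : ℝ
  θ₁ : ℝ
  θ₂ : ℝ
  W : ℝ → ℝ
  g_pos : 0 < g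
  visc_pos : 0 < visc
  σ_pos : 0 < σ
  β_pos : 0 < β
  /-- Young's relation. -/
  young : |γsv - γsf| / σ < 1
  /-- The sessile drop is `θ₁ = θ₂ = 0`; otherwise the angles are acute. -/
  θ₁_mem : θ₁ ∈ Ico 0 (π / 2)
  θ₂_mem : θ₂ ∈ Ico 0 (π / 2)
  /-- `W` is a `C²`, strictly increasing diffeomorphism of the line that fixes `0`. -/
  W_contDiff : ContDiff ℝ 2 W
  W_strictMono : StrictMono W
  W_surjective : Function.Surjective W
  W_deriv_ne : ∀ z, deriv W z ≠ 0
  W_zero : W 0 = 0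

/-- The jump `⟦γ⟧ = γ_sv - γ_sf`. -/
def Params.jump (p : Params) : ℝ := p.γsv - p.γsf

/-- Polar angle of the right wall. -/
def Params.lo (p : Params) : ℝ := p.θ₂

/-- Polar angle of the left wall. -/
def Params.hi (p : Params) : ℝ := π - p.θ₁

/-! ### Geometry in polar coordinates -/

/-- The unit radial vector at polar angle `θ`. -/
def eR (θ : ℝ) : Plane := !₂[cos θ, sin θ]

/-- The unit angular vector at polar angle `θ`. -/
def ePhi (θ : ℝ) : Plane := !₂[-sin θ, cos θ]

/-- The fluid domain below the free surface `r = ρ(θ)`. -/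
def fluidDomain (p : Params) (ρ : ℝ → ℝ) : Set Plane :=
  {x | ∃ θ ∈ Ioo p.lo p.hi, ∃ r ∈ Ioo 0 (ρ θ), x = r • eR θ}

/-- The pole and the two contact points. -/
def corners (p : Params) (ρ : ℝ → ℝ) : Set Plane :=
  {0, ρ p.lo • eR p.lo, ρ p.hi • eR p.hi}

/-- The closed fluid domain without the pole and the contact points. -/
def regularPart (p : Params) (ρ : ℝ → ℝ) : Set Plane :=
  closure (fluidDomain p ρ) \ corners p ρ

/-- The angular derivative on the closed interval of angles (one-sided at the walls). -/
def dTheta (p : Params) (f : ℝ → ℝ) (θ : ℝ) : ℝ := derivWithin f (Icc p.lo p.hi) θ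

/-- The arc-length density `√(ρ² + ρ'²)` of the free surface. -/
def arcDensity (p : Params) (ρ : ℝ → ℝ) (θ : ℝ) : ℝ := √(ρ θ ^ 2 + dTheta p ρ θ ^ 2)

/-- The mean curvature operator
`(1/ρ) (-ρ/√(ρ² + ρ'²) + ∂_θ (ρ'/√(ρ² + ρ'²)))`. -/
def meanCurv (p : Params) (ρ : ℝ → ℝ) (θ : ℝ) : ℝ :=
  1 / ρ θ * (-(ρ θ / arcDensity p ρ θ)
    + deriv (fun φ => dTheta p ρ φ / arcDensity p ρ φ) θ)

/-- The outward normal `𝒩 = ρ e_r - ρ' e_φ` of the free surface, of length `√(ρ² + ρ'²)`. -/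
def normalN (p : Params) (ρ : ℝ → ℝ) (θ : ℝ) : Plane := ρ θ • eR θ - dTheta p ρ θ • ePhi θ

/-- The outward unit normal of the free surface. -/
def unitNormal (p : Params) (ρ : ℝ → ℝ) (θ : ℝ) : Plane :=
  (1 / arcDensity p ρ θ) • normalN p ρ θ

/-! ### Differential operators and stress -/

/-- The velocity gradient `(∂_j v_i)_{ij}`, taken relative to the set `D`. In the interior of `D`
this is the usual gradient; at boundary points it is the gradient from inside. -/
def grad (D : Set Plane) (v : Plane → Plane) (x : Plane) : Matrix (Fin 2) (Fin 2) ℝ :=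
  Matrix.of fun i j => (fderivWithin ℝ v D x (EuclideanSpace.single j 1)) i

/-- The symmetrized gradient `𝔻v = Dv + (Dv)ᵀ`. -/
def symGrad (D : Set Plane) (v : Plane → Plane) (x : Plane) : Matrix (Fin 2) (Fin 2) ℝ :=
  grad D v x + (grad D v x).transpose

/-- The squared Frobenius norm `|𝔻v|²`. -/
def symGradSq (D : Set Plane) (v : Plane → Plane) (x : Plane) : ℝ :=
  ∑ i, ∑ j, symGrad D v x i j ^ 2

/-- The viscous stress tensor `S(P, v) = P I - visc 𝔻v`. -/
def stress (visc : ℝ) (D : Set Plane) (q : Plane → ℝ) (v : Plane → Plane) (x : Plane) :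
    Matrix (Fin 2) (Fin 2) ℝ :=
  q x • (1 : Matrix (Fin 2) (Fin 2) ℝ) - visc • symGrad D v x

/-- A matrix applied to a vector of the plane. -/
def act (M : Matrix (Fin 2) (Fin 2) ℝ) (n : Plane) : Plane := WithLp.toLp 2 (M.mulVec n.ofLp)

/-- The divergence of a vector field. -/
def divVec (v : Plane → Plane) (x : Plane) : ℝ :=
  ∑ i, (fderiv ℝ v x (EuclideanSpace.single i 1)) i

/-- The row-wise divergence of a matrix field. -/
def divMat (M : Plane → Matrix (Fin 2) (Fin 2) ℝ) (x : Plane) : Plane :=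
  WithLp.toLp 2 fun i => ∑ j, fderiv ℝ (fun y => M y i j) x (EuclideanSpace.single j 1)

/-! ### Solutions -/

/-- Regularity of a classical solution on the time set `J`. The velocity is continuous up to the
boundary; the velocity gradient and the pressure are continuous up to the boundary except possibly
at the pole and at the contact points, where they and `∂_t u` may blow up like `d^(l-1)` for some
`l > 0`, with `d` the distance to these points (`l = 1` is boundedness). -/
structure Regularity (p : Params) (J : Set ℝ) (ρ : ℝ → ℝ → ℝ) (u : ℝ → Plane → Plane)
    (P : ℝ → Plane → ℝ) : Prop where
  ρ_pos : ∀ t ∈ J, ∀ θ ∈ Icc p.lo p.hi, 0 < ρ t θ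
  ρ_diff : ∀ t ∈ J, DifferentiableOn ℝ (ρ t) (Icc p.lo p.hi)
  ρ_contDiff : ∀ t ∈ J, ContDiffOn ℝ 2 (ρ t) (Ioo p.lo p.hi)
  ρ_time_diff : ∀ t ∈ J, ∀ θ ∈ Icc p.lo p.hi, DifferentiableAt ℝ (fun s => ρ s θ) t
  dρ_time_diff : ∀ t ∈ J, ∀ θ ∈ Icc p.lo p.hi,
    DifferentiableAt ℝ (fun s => dTheta p (ρ s) θ) t
  ρ_cont : ContinuousOn (fun z : ℝ × ℝ => ρ z.1 z.2) (J ×ˢ Icc p.lo p.hi)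
  dρ_cont : ContinuousOn (fun z : ℝ × ℝ => dTheta p (ρ z.1) z.2) (J ×ˢ Icc p.lo p.hi)
  ρ_time_cont : ContinuousOn (fun z : ℝ × ℝ => deriv (fun s => ρ s z.2) z.1)
    (J ×ˢ Icc p.lo p.hi)
  dρ_time_cont : ContinuousOn (fun z : ℝ × ℝ => deriv (fun s => dTheta p (ρ s) z.2) z.1)
    (J ×ˢ Icc p.lo p.hi)
  u_cont : ContinuousOn (fun z : ℝ × Plane => u z.1 z.2)
    {z | z.1 ∈ J ∧ z.2 ∈ closure (fluidDomain p (ρ z.1))}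
  u_contDiff_one : ContDiffOn ℝ 1 (fun z : ℝ × Plane => u z.1 z.2)
    {z | z.1 ∈ J ∧ z.2 ∈ fluidDomain p (ρ z.1)}
  u_contDiff_two : ∀ t ∈ J, ContDiffOn ℝ 2 (u t) (fluidDomain p (ρ t))
  u_diff : ∀ t ∈ J, DifferentiableOn ℝ (u t) (regularPart p (ρ t))
  du_cont : ∀ t ∈ J, ContinuousOn (fderivWithin ℝ (u t) (regularPart p (ρ t)))
    (regularPart p (ρ t))
  P_contDiff : ∀ t ∈ J, ContDiffOn ℝ 1 (P t) (fluidDomain p (ρ t))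
  P_cont : ∀ t ∈ J, ContinuousOn (P t) (regularPart p (ρ t))
  growth : ∀ t₀ ∈ J, ∃ C l ε : ℝ, 0 < l ∧ 0 < ε ∧ ∀ t ∈ J, |t - t₀| < ε →
    ∀ x ∈ fluidDomain p (ρ t),
      ‖fderiv ℝ (u t) x‖ + ‖deriv (fun s => u s x) t‖ + |P t x|
        ≤ C * Metric.infDist x (corners p (ρ t)) ^ (l - 1)

/-- `(ρ, u, P)` is a classical solution of the contact-line Navier-Stokes system at the times
of `J`. -/
structure IsSolution (p : Params) (J : Set ℝ) (ρ : ℝ → ℝ → ℝ) (u : ℝ → Plane → Plane)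
    (P : ℝ → Plane → ℝ) : Prop where
  regularity : Regularity p J ρ u P
  /-- `∂_t u + u · ∇u + div S(P, u) = 0` in `Ω(t)`. -/
  momentum : ∀ t ∈ J, ∀ x ∈ fluidDomain p (ρ t),
    deriv (fun s => u s x) t + fderiv ℝ (u t) x (u t x)
      + divMat (stress p.visc (regularPart p (ρ t)) (P t) (u t)) x = 0
  /-- `div u = 0` in `Ω(t)`. -/
  incompressible : ∀ t ∈ J, ∀ x ∈ fluidDomain p (ρ t), divVec (u t) x = 0
  /-- `S(P, u) ν = (g ρ sin θ - σ H(ρ)) ν` on `Σ(t)`. -/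
  dynamic : ∀ t ∈ J, ∀ θ ∈ Ioo p.lo p.hi,
    act (stress p.visc (regularPart p (ρ t)) (P t) (u t) (ρ t θ • eR θ))
        (unitNormal p (ρ t) θ)
      = (p.g * ρ t θ * sin θ - p.σ * meanCurv p (ρ t) θ) • unitNormal p (ρ t) θ
  /-- `∂_t ρ = (1/ρ) u · 𝒩` on `Σ(t)`. -/
  kinematic : ∀ t ∈ J, ∀ θ ∈ Icc p.lo p.hi,
    deriv (fun s => ρ s θ) t
      = 1 / ρ t θ * inner ℝ (u t (ρ t θ • eR θ)) (normalN p (ρ t) θ)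
  /-- `(S(P, u) ν - β u) · τ = 0` on the right wall, where `ν = -e_φ`, `τ = e_r`. -/
  slip_lo : ∀ t ∈ J, ∀ r ∈ Ioo 0 (ρ t p.lo),
    inner ℝ (act (stress p.visc (regularPart p (ρ t)) (P t) (u t) (r • eR p.lo)) (-ePhi p.lo)
      - p.β • u t (r • eR p.lo)) (eR p.lo) = 0
  /-- `(S(P, u) ν - β u) · τ = 0` on the left wall, where `ν = e_φ`, `τ = e_r`. -/
  slip_hi : ∀ t ∈ J, ∀ r ∈ Ioo 0 (ρ t p.hi),
    inner ℝ (act (stress p.visc (regularPart p (ρ t)) (P t) (u t) (r • eR p.hi)) (ePhi p.hi)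
      - p.β • u t (r • eR p.hi)) (eR p.hi) = 0
  /-- `u · ν = 0` on the right wall. -/
  nonpenetration_lo : ∀ t ∈ J, ∀ r ∈ Ioo 0 (ρ t p.lo),
    inner ℝ (u t (r • eR p.lo)) (-ePhi p.lo) = 0
  /-- `u · ν = 0` on the left wall. -/
  nonpenetration_hi : ∀ t ∈ J, ∀ r ∈ Ioo 0 (ρ t p.hi),
    inner ℝ (u t (r • eR p.hi)) (ePhi p.hi) = 0
  /-- Contact-point law at the left wall. -/
  contact_hi : ∀ t ∈ J, p.W (deriv (fun s => ρ s p.hi) t)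
    = p.jump - p.σ * (dTheta p (ρ t) p.hi / arcDensity p (ρ t) p.hi)
  /-- Contact-point law at the right wall. -/
  contact_lo : ∀ t ∈ J, p.W (deriv (fun s => ρ s p.lo) t)
    = p.jump + p.σ * (dTheta p (ρ t) p.lo / arcDensity p (ρ t) p.lo)

/-! ### Energy and dissipation -/

/-- The gravity-capillary-wetting energy
`(g/3) ∫ ρ³ sin θ + σ ∫ √(ρ² + ρ'²) - ⟦γ⟧ (ρ(π - θ₁) + ρ(θ₂))`. -/
def surfaceEnergy (p : Params) (ρ : ℝ → ℝ) : ℝ :=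
  p.g / 3 * (∫ θ in p.lo..p.hi, ρ θ ^ 3 * sin θ)
    + p.σ * (∫ θ in p.lo..p.hi, arcDensity p ρ θ)
    - p.jump * (ρ p.hi + ρ p.lo)

/-- The total energy `∫_{Ω(t)} ½|u|² + 𝓕(ρ)`. -/
def totalEnergy (p : Params) (ρ : ℝ → ℝ → ℝ) (u : ℝ → Plane → Plane) (t : ℝ) : ℝ :=
  (∫ x in fluidDomain p (ρ t), 1 / 2 * ‖u t x‖ ^ 2) + surfaceEnergy p (ρ t)

/-- The viscous dissipation `∫_{Ω} (visc/2) |𝔻v|²`. -/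
def viscousDissipation (p : Params) (ρ : ℝ → ℝ) (v : Plane → Plane) : ℝ :=
  ∫ x in fluidDomain p ρ, p.visc / 2 * symGradSq (regularPart p ρ) v x

/-- The slip dissipation `∫_{Σ_s} β |v|²` along the wetted parts of the two walls, which are
parametrized by arc length. -/
def slipDissipation (p : Params) (ρ : ℝ → ℝ) (v : Plane → Plane) : ℝ :=
  (∫ r in (0 : ℝ)..(ρ p.lo), p.β * ‖v (r • eR p.lo)‖ ^ 2)
    + ∫ r in (0 : ℝ)..(ρ p.hi), p.β * ‖v (r • eR p.hi)‖ ^ 2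

/-- Position of the left contact point along its wall, measured from the pole. -/
def leftContact (p : Params) (ρ : ℝ → ℝ → ℝ) (t : ℝ) : ℝ := ρ t p.hi

/-- Position of the right contact point along its wall, measured from the pole. -/
def rightContact (p : Params) (ρ : ℝ → ℝ → ℝ) (t : ℝ) : ℝ := ρ t p.lo

end Droplet

end

noncomputable section

namespace Droplet

lemma Params.lo_nonneg (p : Params) : 0 ≤ p.lo := p.θ₂_mem.1

lemma Params.hi_le_pi (p : Params) : p.hi ≤ π := by
  have := p.θ₁_mem.1
  unfold Params.hi; linarith

lemma Params.lo_lt_hi (p : Params) : p.lo < p.hi := by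
  have h1 := p.θ₁_mem.2
  have h2 := p.θ₂_mem.2
  unfold Params.hi Params.lo; linarith

/-! ### The polar frame -/

@[simp] lemma eR_zero (θ : ℝ) : eR θ 0 = cos θ := rfl
@[simp] lemma eR_one (θ : ℝ) : eR θ 1 = sin θ := rfl
@[simp] lemma ePhi_zero (θ : ℝ) : ePhi θ 0 = -sin θ := rfl
@[simp] lemma ePhi_one (θ : ℝ) : ePhi θ 1 = cos θ := rfl

lemma plane_inner (x y : Plane) : inner ℝ x y = x 0 * y 0 + x 1 * y 1 := by
  rw [PiLp.inner_apply, Fin.sum_univ_two]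
  simp [mul_comm]

lemma plane_norm_sq (x : Plane) : ‖x‖ ^ 2 = x 0 ^ 2 + x 1 ^ 2 := by
  rw [EuclideanSpace.real_norm_sq_eq, Fin.sum_univ_two]

lemma plane_ext {x y : Plane} (h0 : x 0 = y 0) (h1 : x 1 = y 1) : x = y := by
  ext i; fin_cases i <;> assumption

lemma hasDerivAt_plane {f : ℝ → Plane} {v : Plane} {t : ℝ}
    (h0 : HasDerivAt (fun s => f s 0) (v 0) t) (h1 : HasDerivAt (fun s => f s 1) (v 1) t) :
    HasDerivAt f v t := by
  rw [← hasDerivWithinAt_univ, hasDerivWithinAt_iff_hasFDerivWithinAt,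
    hasFDerivWithinAt_euclidean]
  intro i
  rw [hasFDerivWithinAt_univ]
  fin_cases i
  · exact h0.hasFDerivAt.congr_fderiv (by ext; simp)
  · exact h1.hasFDerivAt.congr_fderiv (by ext; simp)

lemma hasDerivAt_eR (θ : ℝ) : HasDerivAt eR (ePhi θ) θ :=
  hasDerivAt_plane (hasDerivAt_cos θ) (hasDerivAt_sin θ)

lemma hasDerivAt_ePhi (θ : ℝ) : HasDerivAt ePhi (-eR θ) θ :=
  hasDerivAt_plane (hasDerivAt_sin θ).neg (hasDerivAt_cos θ)

lemma continuous_eR : Continuous eR :=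
  continuous_iff_continuousAt.2 fun θ => (hasDerivAt_eR θ).continuousAt

lemma continuous_ePhi : Continuous ePhi :=
  continuous_iff_continuousAt.2 fun θ => (hasDerivAt_ePhi θ).continuousAt

lemma norm_eR (θ : ℝ) : ‖eR θ‖ = 1 := by
  have h := plane_norm_sq (eR θ)
  rw [eR_zero, eR_one, cos_sq_add_sin_sq] at h
  exact (sq_eq_sq₀ (norm_nonneg _) zero_le_one).1 (by simpa using h)

lemma norm_ePhi (θ : ℝ) : ‖ePhi θ‖ = 1 := by
  have h := plane_norm_sq (ePhi θ)
  rw [ePhi_zero, ePhi_one, neg_sq, sin_sq_add_cos_sq] at h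
  exact (sq_eq_sq₀ (norm_nonneg _) zero_le_one).1 (by simpa using h)

/-! ### The fluid domain in polar coordinates -/

/-- The polar parametrization of the fluid domain over the fixed cell `(0,1) × (lo, hi)`. -/
def scaledPolar (ρ : ℝ → ℝ) (z : ℝ × ℝ) : Plane := (z.1 * ρ z.2) • eR z.2

/-- The parameter cell. -/
def cell (p : Params) : Set (ℝ × ℝ) := Ioo 0 1 ×ˢ Ioo p.lo p.hi

lemma isOpen_cell (p : Params) : IsOpen (cell p) := isOpen_Ioo.prod isOpen_Ioo

lemma closure_cell (p : Params) : closure (cell p) = Icc 0 1 ×ˢ Icc p.lo p.hi := by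
  rw [cell, closure_prod_eq, closure_Ioo zero_ne_one, closure_Ioo p.lo_lt_hi.ne]

lemma fluidDomain_eq_image (p : Params) {ρ : ℝ → ℝ} (hρ : ∀ θ ∈ Icc p.lo p.hi, 0 < ρ θ) :
    fluidDomain p ρ = scaledPolar ρ '' cell p := by
  ext x
  constructor
  · rintro ⟨θ, hθ, r, hr, rfl⟩
    have h := hρ θ (Ioo_subset_Icc_self hθ)
    refine ⟨(r / ρ θ, θ), ⟨⟨div_pos hr.1 h, (div_lt_one h).2 hr.2⟩, hθ⟩, ?_⟩
    simp [scaledPolar, div_mul_cancel₀ _ h.ne']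
  · rintro ⟨⟨s, θ⟩, ⟨hs, hθ⟩, rfl⟩
    have h := hρ θ (Ioo_subset_Icc_self hθ)
    refine ⟨θ, hθ, s * ρ θ, ⟨mul_pos hs.1 h, ?_⟩, rfl⟩
    have := hs.2
    simp only at this
    nlinarith

lemma mem_polarCoord_target (p : Params) {r θ : ℝ} (hr : 0 < r) (hθ : θ ∈ Ioo p.lo p.hi) :
    (r, θ) ∈ polarCoord.target := by
  rw [polarCoord_target]
  have := p.lo_nonneg
  have := p.hi_le_pi
  exact ⟨hr, by linarith [hθ.1, pi_pos], by linarith [hθ.2]⟩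

lemma mem_fluidDomain_iff (p : Params) {ρ : ℝ → ℝ} (x : Plane) :
    x ∈ fluidDomain p ρ ↔ (x 0, x 1) ∈ polarCoord.source ∧
      (polarCoord (x 0, x 1)).2 ∈ Ioo p.lo p.hi ∧
      (polarCoord (x 0, x 1)).1 - ρ (polarCoord (x 0, x 1)).2 < 0 := by
  constructor
  · rintro ⟨θ, hθ, r, hr, rfl⟩
    have ht := mem_polarCoord_target p hr.1 hθ
    have hx : ((r • eR θ : Plane) 0, (r • eR θ : Plane) 1) = polarCoord.symm (r, θ) := rfl
    rw [hx, polarCoord.right_inv ht]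
    exact ⟨polarCoord.map_target ht, hθ, sub_neg.2 hr.2⟩
  · rintro ⟨hx, hθ, hr⟩
    have ht := polarCoord.map_source hx
    have h0 : 0 < (polarCoord (x 0, x 1)).1 := by
      rw [polarCoord_target] at ht
      exact ht.1
    refine ⟨_, hθ, _, ⟨h0, sub_neg.1 hr⟩, ?_⟩
    have h := polarCoord.left_inv hx
    exact plane_ext (congrArg Prod.fst h).symm (congrArg Prod.snd h).symm

lemma isOpen_spacetime (p : Params) {J : Set ℝ} (hJ : IsOpen J) {ρ : ℝ → ℝ → ℝ}
    (hρ : ContinuousOn (fun z : ℝ × ℝ => ρ z.1 z.2) (J ×ˢ Icc p.lo p.hi)) :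
    IsOpen {z : ℝ × Plane | z.1 ∈ J ∧ z.2 ∈ fluidDomain p (ρ z.1)} := by
  let q : ℝ × Plane → ℝ × ℝ := fun z => (z.2 0, z.2 1)
  have hq : Continuous q := by fun_prop
  have hpc : ContinuousOn polarCoord polarCoord.source := polarCoord.continuousOn
  let U : Set (ℝ × Plane) := {z | z.1 ∈ J} ∩ q ⁻¹' polarCoord.source
  have hU : IsOpen U := (hJ.preimage continuous_fst).inter (polarCoord.open_source.preimage hq)
  have hc : ContinuousOn (fun z => polarCoord (q z)) U :=
    hpc.comp hq.continuousOn fun z hz => hz.2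
  have hV := (continuous_snd.comp_continuousOn hc).isOpen_inter_preimage hU
    (isOpen_Ioo (a := p.lo) (b := p.hi))
  have hd : ContinuousOn (fun z => (polarCoord (q z)).1 - ρ z.1 (polarCoord (q z)).2)
      (U ∩ (Prod.snd ∘ fun z => polarCoord (q z)) ⁻¹' Ioo p.lo p.hi) := by
    refine (continuous_fst.comp_continuousOn (hc.mono inter_subset_left)).sub ?_
    refine hρ.comp (f := fun z : ℝ × Plane => (z.1, (polarCoord (q z)).2))
      (continuous_fst.continuousOn.prodMk
        (continuous_snd.comp_continuousOn (hc.mono inter_subset_left))) ?_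
    intro z hz
    exact ⟨hz.1.1, Ioo_subset_Icc_self hz.2⟩
  have hW := hd.isOpen_inter_preimage hV isOpen_Iio (t := Iio (0 : ℝ))
  convert hW using 1
  ext z
  simp only [mem_fluidDomain_iff, U, q, mem_inter_iff, mem_preimage, mem_ofPred_eq, mem_Iio,
    Function.comp]
  tauto

lemma isOpen_fluidDomain (p : Params) {ρ : ℝ → ℝ} (hρ : ContinuousOn ρ (Icc p.lo p.hi)) :
    IsOpen (fluidDomain p ρ) := by
  have h := isOpen_spacetime p isOpen_univ (ρ := fun _ => ρ)
    (hρ.comp continuous_snd.continuousOn fun z hz => hz.2)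
  have := h.preimage (Continuous.prodMk_right (0 : ℝ) : Continuous fun x : Plane => ((0 : ℝ), x))
  simpa using this

lemma continuousOn_scaledPolar (p : Params) {ρ : ℝ → ℝ} (hρ : ContinuousOn ρ (Icc p.lo p.hi)) :
    ContinuousOn (scaledPolar ρ) (Icc 0 1 ×ˢ Icc p.lo p.hi) := by
  unfold scaledPolar
  refine (continuous_fst.continuousOn.mul ?_).smul (continuous_eR.comp continuous_snd).continuousOn
  exact hρ.comp continuous_snd.continuousOn fun z hz => hz.2

lemma scaledPolar_mem_closure (p : Params) {ρ : ℝ → ℝ} (hρ : ContinuousOn ρ (Icc p.lo p.hi))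
    (hpos : ∀ θ ∈ Icc p.lo p.hi, 0 < ρ θ) {z : ℝ × ℝ} (hz : z ∈ Icc (0 : ℝ) 1 ×ˢ Icc p.lo p.hi) :
    scaledPolar ρ z ∈ closure (fluidDomain p ρ) := by
  rw [← closure_cell] at hz
  rw [fluidDomain_eq_image p hpos]
  exact ContinuousOn.image_closure (by rw [closure_cell]; exact continuousOn_scaledPolar p hρ)
    (mem_image_of_mem _ hz)

/-- The plane as a product. -/
def planeEquiv : Plane ≃ᵐ ℝ × ℝ :=
  (MeasurableEquiv.toLp 2 (Fin 2 → ℝ)).symm.trans MeasurableEquiv.finTwoArrow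

lemma measurePreserving_planeEquiv : MeasurePreserving planeEquiv volume volume :=
  (volume_preserving_finTwoArrow ℝ).comp
    (EuclideanSpace.volume_preserving_symm_measurableEquiv_toLp (Fin 2))

lemma injOn_scaledPolar (p : Params) {ρ : ℝ → ℝ} (hρ : ∀ θ ∈ Icc p.lo p.hi, 0 < ρ θ) :
    InjOn (scaledPolar ρ) (cell p) := by
  rintro ⟨s, θ⟩ ⟨hs, hθ⟩ ⟨s', θ'⟩ ⟨hs', hθ'⟩ h
  have h1 := hρ θ (Ioo_subset_Icc_self hθ)
  have h2 := hρ θ' (Ioo_subset_Icc_self hθ')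
  have key : polarCoord.symm (s * ρ θ, θ) = polarCoord.symm (s' * ρ θ', θ') :=
    congrArg planeEquiv h
  have := polarCoord.symm.injOn (mem_polarCoord_target p (mul_pos hs.1 h1) hθ)
    (mem_polarCoord_target p (mul_pos hs'.1 h2) hθ') key
  obtain ⟨ha, rfl⟩ := Prod.mk.inj this
  exact Prod.ext (mul_right_cancel₀ h1.ne' ha) rfl

/-- The derivative of the polar parametrization, in Cartesian coordinates. -/
def scaledPolarDeriv (ρ dρ : ℝ → ℝ) (z : ℝ × ℝ) : ℝ × ℝ →L[ℝ] ℝ × ℝ :=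
  (Matrix.toLin (.finTwoProd ℝ) (.finTwoProd ℝ)
    !![ρ z.2 * cos z.2, z.1 * dρ z.2 * cos z.2 - z.1 * ρ z.2 * sin z.2;
       ρ z.2 * sin z.2, z.1 * dρ z.2 * sin z.2 + z.1 * ρ z.2 * cos z.2]).toContinuousLinearMap

lemma hasFDerivAt_planeEquiv_scaledPolar {ρ dρ : ℝ → ℝ} {z : ℝ × ℝ}
    (h : HasDerivAt ρ (dρ z.2) z.2) :
    HasFDerivAt (fun z => planeEquiv (scaledPolar ρ z)) (scaledPolarDeriv ρ dρ z) z := by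
  unfold scaledPolarDeriv
  rw [Matrix.toLin_finTwoProd_toContinuousLinearMap]
  have h0 : HasFDerivAt (Prod.snd : ℝ × ℝ → ℝ) (ContinuousLinearMap.snd ℝ ℝ ℝ) z := hasFDerivAt_snd
  have hf : HasFDerivAt (Prod.fst : ℝ × ℝ → ℝ) (ContinuousLinearMap.fst ℝ ℝ ℝ) z := hasFDerivAt_fst
  have h1 := hf.mul (h.comp_hasFDerivAt z h0)
  have h2 := HasFDerivAt.prodMk (𝕜 := ℝ)
    (h1.mul ((hasDerivAt_cos z.2).comp_hasFDerivAt z h0))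
    (h1.mul ((hasDerivAt_sin z.2).comp_hasFDerivAt z h0))
  refine h2.congr_fderiv ?_
  ext <;> simp <;> ring

lemma det_scaledPolarDeriv (ρ dρ : ℝ → ℝ) (z : ℝ × ℝ) :
    (scaledPolarDeriv ρ dρ z).det = z.1 * ρ z.2 ^ 2 := by
  unfold scaledPolarDeriv
  simp only [LinearMap.det_toContinuousLinearMap, LinearMap.det_toLin, Matrix.det_fin_two_of]
  linear_combination z.1 * ρ z.2 ^ 2 * (cos_sq_add_sin_sq z.2)

lemma hasDerivAt_of_differentiableOn (p : Params) {ρ : ℝ → ℝ}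
    (hρ : DifferentiableOn ℝ ρ (Icc p.lo p.hi)) {θ : ℝ} (hθ : θ ∈ Ioo p.lo p.hi) :
    HasDerivAt ρ (dTheta p ρ θ) θ :=
  (hρ θ (Ioo_subset_Icc_self hθ)).hasDerivWithinAt.hasDerivAt (Icc_mem_nhds hθ.1 hθ.2)

lemma fluidDomain_change_of_variables (p : Params) {ρ : ℝ → ℝ}
    (hd : DifferentiableOn ℝ ρ (Icc p.lo p.hi)) (hpos : ∀ θ ∈ Icc p.lo p.hi, 0 < ρ θ)
    (f : Plane → ℝ) :
    (∫ x in fluidDomain p ρ, f x = ∫ z in cell p, z.1 * ρ z.2 ^ 2 * f (scaledPolar ρ z)) ∧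
    (IntegrableOn f (fluidDomain p ρ) ↔
      IntegrableOn (fun z => z.1 * ρ z.2 ^ 2 * f (scaledPolar ρ z)) (cell p)) := by
  have hm := (isOpen_cell p).measurableSet
  have hder : ∀ z ∈ cell p, HasFDerivWithinAt (fun z => planeEquiv (scaledPolar ρ z))
      (scaledPolarDeriv ρ (dTheta p ρ) z) (cell p) z := fun z hz =>
    (hasFDerivAt_planeEquiv_scaledPolar
      (hasDerivAt_of_differentiableOn p hd hz.2)).hasFDerivWithinAt
  have hinj : InjOn (fun z => planeEquiv (scaledPolar ρ z)) (cell p) :=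
    fun a ha b hb h => injOn_scaledPolar p hpos ha hb (planeEquiv.injective h)
  have hset : fluidDomain p ρ
      = planeEquiv ⁻¹' ((fun z => planeEquiv (scaledPolar ρ z)) '' cell p) := by
    rw [fluidDomain_eq_image p hpos, ← image_image planeEquiv,
      preimage_image_eq _ planeEquiv.injective]
  have hJ : ∀ z ∈ cell p, |(scaledPolarDeriv ρ (dTheta p ρ) z).det| • f (scaledPolar ρ z)
      = z.1 * ρ z.2 ^ 2 * f (scaledPolar ρ z) := by
    intro z hz
    have : 0 < z.1 := hz.1.1
    rw [det_scaledPolarDeriv, abs_of_nonneg (by positivity), smul_eq_mul]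
  have hf : f = (fun y => f (planeEquiv.symm y)) ∘ planeEquiv := by ext x; simp
  constructor
  · have h := integral_image_eq_integral_abs_det_fderiv_smul volume hm hder hinj
      fun y => f (planeEquiv.symm y)
    rw [← measurePreserving_planeEquiv.setIntegral_preimage_emb
      planeEquiv.measurableEmbedding] at h
    simp only [MeasurableEquiv.symm_apply_apply] at h
    rw [hset, h]
    exact setIntegral_congr_fun hm hJ
  · have h := integrableOn_image_iff_integrableOn_abs_det_fderiv_smul volume hm hder hinj
      fun y => f (planeEquiv.symm y)
    rw [← measurePreserving_planeEquiv.integrableOn_comp_preimage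
      planeEquiv.measurableEmbedding, ← hset, ← hf] at h
    rw [h]
    simp only [MeasurableEquiv.symm_apply_apply]
    exact integrableOn_congr_fun hJ hm

/-! ### Distances to the contact points -/

lemma norm_sub_sq_polar (r R θ φ : ℝ) :
    ‖r • eR θ - R • eR φ‖ ^ 2 = r ^ 2 + R ^ 2 - 2 * r * R * cos (θ - φ) := by
  rw [plane_norm_sq, cos_sub]
  simp only [PiLp.sub_apply, PiLp.smul_apply, eR_zero, eR_one, smul_eq_mul]
  linear_combination r ^ 2 * (cos_sq_add_sin_sq θ) + R ^ 2 * (cos_sq_add_sin_sq φ)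

lemma abs_sub_le_norm_polar {r R : ℝ} (hr : 0 ≤ r) (hR : 0 ≤ R) (θ φ : ℝ) :
    |r - R| ≤ ‖r • eR θ - R • eR φ‖ := by
  apply abs_le_of_sq_le_sq _ (norm_nonneg _)
  rw [norm_sub_sq_polar]
  nlinarith [mul_nonneg hr hR, cos_le_one (θ - φ)]

lemma angle_le_norm_polar {r R θ φ : ℝ} (hr : 0 ≤ r) (hR : 0 ≤ R) (h : |θ - φ| ≤ π) :
    R / π * |θ - φ| ≤ ‖r • eR θ - R • eR φ‖ := by
  have hs : |θ - φ| / π ≤ sin (|θ - φ| / 2) := by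
    have := mul_le_sin (x := |θ - φ| / 2) (by positivity) (by linarith)
    refine le_trans (le_of_eq ?_) this
    field_simp
  have h1 : (R / π * |θ - φ|) ^ 2 ≤ (R * sin (|θ - φ| / 2)) ^ 2 := by
    have h3 : 0 ≤ |θ - φ| / π := by positivity
    have : R / π * |θ - φ| = R * (|θ - φ| / π) := by ring
    rw [this]
    gcongr
  have h2 : sin (|θ - φ| / 2) ^ 2 = (1 - cos (θ - φ)) / 2 := by
    rw [sin_sq_eq_half_sub, mul_div_cancel₀ _ two_ne_zero, cos_abs]; ring
  apply le_of_sq_le_sq _ (norm_nonneg _)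
  rw [norm_sub_sq_polar]
  refine h1.trans ?_
  rw [mul_pow, h2]
  set c := cos (θ - φ)
  have c1 : c ≤ 1 := cos_le_one _
  have c2 : -1 ≤ c := neg_one_le_cos _
  by_cases hc : 0 ≤ c
  · nlinarith [sq_nonneg (r - R * c), mul_nonneg (sq_nonneg R)
      (mul_nonneg (sub_nonneg.2 c1) (by linarith : 0 ≤ 1 + 2 * c))]
  · nlinarith [mul_nonneg (mul_nonneg hr hR) (neg_nonneg.2 (not_le.1 hc).le),
      mul_nonneg (sq_nonneg R) (by linarith : 0 ≤ 1 + c), sq_nonneg r]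

lemma contact_dist (p : Params) {ρ : ℝ → ℝ} {m M : ℝ}
    (hd : DifferentiableOn ℝ ρ (Icc p.lo p.hi)) (hm : 0 < m)
    (hρ : ∀ θ ∈ Icc p.lo p.hi, m ≤ ρ θ) (hM : ∀ θ ∈ Icc p.lo p.hi, |dTheta p ρ θ| ≤ M)
    {s θ φ : ℝ} (hs : s ∈ Icc (0 : ℝ) 1) (hθ : θ ∈ Icc p.lo p.hi) (hφ : φ ∈ Icc p.lo p.hi) :
    m / π * |θ - φ| ≤ ‖scaledPolar ρ (s, θ) - ρ φ • eR φ‖ ∧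
    m / (1 + M * π / m) * (1 - s) ≤ ‖scaledPolar ρ (s, θ) - ρ φ • eR φ‖ := by
  have hp := pi_pos
  have hM0 : 0 ≤ M := (abs_nonneg _).trans (hM θ hθ)
  have hρθ := hρ θ hθ
  have hρφ := hρ φ hφ
  have hr : 0 ≤ s * ρ θ := mul_nonneg hs.1 (by linarith)
  have hang : |θ - φ| ≤ π := by
    have := p.lo_nonneg
    have := p.hi_le_pi
    rw [abs_le]; constructor <;> linarith [hθ.1, hθ.2, hφ.1, hφ.2]
  have h1 : m / π * |θ - φ| ≤ ‖scaledPolar ρ (s, θ) - ρ φ • eR φ‖ := by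
    refine le_trans ?_ (angle_le_norm_polar hr (by linarith) hang)
    gcongr
  refine ⟨h1, ?_⟩
  have h2 : |s * ρ θ - ρ φ| ≤ ‖scaledPolar ρ (s, θ) - ρ φ • eR φ‖ :=
    abs_sub_le_norm_polar hr (by linarith) θ φ
  have h3 : ‖ρ θ - ρ φ‖ ≤ M * ‖θ - φ‖ :=
    Convex.norm_image_sub_le_of_norm_derivWithin_le hd hM (convex_Icc _ _) hφ hθ
  rw [norm_eq_abs, norm_eq_abs] at h3
  set D := ‖scaledPolar ρ (s, θ) - ρ φ • eR φ‖
  have h4 : |θ - φ| ≤ D * π / m := by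
    rw [le_div_iff₀ hm]
    have : m / π * |θ - φ| * π ≤ D * π := by gcongr
    have e : m / π * |θ - φ| * π = |θ - φ| * m := by field_simp
    linarith
  have h5 : m * (1 - s) ≤ D * (1 + M * π / m) := by
    calc m * (1 - s) ≤ ρ θ * (1 - s) := by
          have := hs.2
          gcongr
      _ = (ρ θ - ρ φ) - (s * ρ θ - ρ φ) := by ring
      _ ≤ M * |θ - φ| + D := by linarith [le_abs_self (ρ θ - ρ φ), neg_abs_le (s * ρ θ - ρ φ)]
      _ ≤ M * (D * π / m) + D := by gcongr
      _ = _ := by ring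
  have h6 : 0 < 1 + M * π / m := by positivity
  rw [div_mul_eq_mul_div, div_le_iff₀ h6]
  exact h5

/-! ### The divergence theorem on an open rectangle -/

lemma tendsto_setIntegral_exhaustion {α : Type*} [MeasurableSpace α] {ν : Measure α} {Q : Set α}
    {s : ℕ → Set α} {f : α → ℝ} (hQ : MeasurableSet Q) (hs : ∀ n, MeasurableSet (s n))
    (hsub : ∀ n, s n ⊆ Q) (hev : ∀ z ∈ Q, ∀ᶠ n in atTop, z ∈ s n) (hf : IntegrableOn f Q ν) :
    Tendsto (fun n => ∫ z in s n, f z ∂ν) atTop (𝓝 (∫ z in Q, f z ∂ν)) := by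
  have hc : AECover (ν.restrict Q) atTop s := ⟨(ae_restrict_iff' hQ).2 (ae_of_all _ hev), hs⟩
  have h := hc.integral_tendsto_of_countably_generated hf
  refine h.congr fun n => ?_
  rw [Measure.restrict_restrict (hs n), inter_eq_self_of_subset_left (hsub n)]

lemma tendsto_integral_edge {c d : ℝ} (hcd : c < d) {k φ : ℝ → ℝ} {F : ℕ → ℝ → ℝ} {cn dn : ℕ → ℝ}
    (hc : ∀ n, c < cn n) (hd : ∀ n, dn n < d) (hle : ∀ n, cn n ≤ dn n)
    (hcn : Tendsto cn atTop (𝓝 c)) (hdn : Tendsto dn atTop (𝓝 d))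
    (hF : ∀ n, ContinuousOn (F n) (Ioo c d)) (hk : IntegrableOn k (Ioo c d))
    (hFk : ∀ n, ∀ y ∈ Ioo c d, |F n y| ≤ k y)
    (hlim : ∀ y ∈ Ioo c d, Tendsto (fun n => F n y) atTop (𝓝 (φ y))) :
    Tendsto (fun n => ∫ y in (cn n)..(dn n), F n y) atTop (𝓝 (∫ y in c..d, φ y)) := by
  have hsub : ∀ n, Ioc (cn n) (dn n) ⊆ Ioo c d := fun n y hy =>
    ⟨(hc n).trans hy.1, hy.2.trans_lt (hd n)⟩
  have h : Tendsto (fun n => ∫ y in Ioo c d, (Ioc (cn n) (dn n)).indicator (F n) y) atTop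
      (𝓝 (∫ y in Ioo c d, φ y)) := by
    refine tendsto_integral_of_dominated_convergence k (fun n => ?_) hk (fun n => ?_) ?_
    · refine (aestronglyMeasurable_indicator_iff measurableSet_Ioc).2 ?_
      rw [Measure.restrict_restrict measurableSet_Ioc, inter_eq_self_of_subset_left (hsub n)]
      exact ((hF n).mono (hsub n)).aestronglyMeasurable measurableSet_Ioc
    · refine (ae_restrict_iff' measurableSet_Ioo).2 (ae_of_all _ fun y hy => ?_)
      exact (norm_indicator_le_norm_self _ _).trans (hFk n y hy)
    · refine (ae_restrict_iff' measurableSet_Ioo).2 (ae_of_all _ fun y hy => ?_)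
      refine (hlim y hy).congr' ?_
      filter_upwards [hcn.eventually_lt_const hy.1, hdn.eventually_const_lt hy.2] with n h1 h2
      rw [indicator_of_mem (show y ∈ Ioc (cn n) (dn n) from ⟨h1, h2.le⟩)]
  rw [intervalIntegral.integral_of_le hcd.le, integral_Ioc_eq_integral_Ioo]
  refine h.congr fun n => ?_
  rw [intervalIntegral.integral_of_le (hle n), setIntegral_indicator measurableSet_Ioc,
    inter_eq_self_of_subset_right (hsub n)]

lemma exists_shrinking {a b : ℝ} (hab : a < b) : ∃ an bn : ℕ → ℝ, (∀ n, a < an n) ∧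
    (∀ n, bn n < b) ∧ (∀ n, an n ≤ bn n) ∧ Tendsto an atTop (𝓝 a) ∧ Tendsto bn atTop (𝓝 b) := by
  have h0 : Tendsto (fun n : ℕ => (b - a) / 2 * (1 / ((n : ℝ) + 1))) atTop (𝓝 0) := by
    simpa using tendsto_one_div_add_atTop_nhds_zero_nat.const_mul ((b - a) / 2)
  have hpos : ∀ n : ℕ, 0 < (b - a) / 2 * (1 / ((n : ℝ) + 1)) := fun n =>
    mul_pos (by linarith) Nat.one_div_pos_of_nat
  have hle : ∀ n : ℕ, (b - a) / 2 * (1 / ((n : ℝ) + 1)) ≤ (b - a) / 2 := fun n => by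
    refine mul_le_of_le_one_right (by linarith) ?_
    rw [div_le_one (by positivity)]
    linarith [(Nat.cast_nonneg n : (0 : ℝ) ≤ n)]
  refine ⟨fun n => a + (b - a) / 2 * (1 / ((n : ℝ) + 1)),
    fun n => b - (b - a) / 2 * (1 / ((n : ℝ) + 1)), fun n => by linarith [hpos n],
    fun n => by linarith [hpos n], fun n => by linarith [hle n], ?_, ?_⟩
  · simpa using h0.const_add a
  · simpa using h0.const_sub b

theorem integral_divergence_Ioo_prod {a b c d : ℝ} (hab : a < b) (hcd : c < d)
    {f g : ℝ × ℝ → ℝ} {f' g' : ℝ × ℝ → ℝ × ℝ →L[ℝ] ℝ} {k h fa fb gc gd : ℝ → ℝ}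
    (Hf : ∀ z ∈ Ioo a b ×ˢ Ioo c d, HasFDerivAt f (f' z) z)
    (Hg : ∀ z ∈ Ioo a b ×ˢ Ioo c d, HasFDerivAt g (g' z) z)
    (Hi : IntegrableOn (fun z => f' z (1, 0) + g' z (0, 1)) (Ioo a b ×ˢ Ioo c d))
    (hk : IntegrableOn k (Ioo c d)) (hfk : ∀ z ∈ Ioo a b ×ˢ Ioo c d, |f z| ≤ k z.2)
    (hh : IntegrableOn h (Ioo a b)) (hgh : ∀ z ∈ Ioo a b ×ˢ Ioo c d, |g z| ≤ h z.1)
    (hfa : ∀ y ∈ Ioo c d, Tendsto (fun x => f (x, y)) (𝓝[>] a) (𝓝 (fa y)))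
    (hfb : ∀ y ∈ Ioo c d, Tendsto (fun x => f (x, y)) (𝓝[<] b) (𝓝 (fb y)))
    (hgc : ∀ x ∈ Ioo a b, Tendsto (fun y => g (x, y)) (𝓝[>] c) (𝓝 (gc x)))
    (hgd : ∀ x ∈ Ioo a b, Tendsto (fun y => g (x, y)) (𝓝[<] d) (𝓝 (gd x))) :
    ∫ z in Ioo a b ×ˢ Ioo c d, (f' z (1, 0) + g' z (0, 1))
      = (((∫ x in a..b, gd x) - ∫ x in a..b, gc x) + ∫ y in c..d, fb y) - ∫ y in c..d, fa y := by
  obtain ⟨an, bn, ha, hb, hle, han, hbn⟩ := exists_shrinking hab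
  obtain ⟨cn, dn, hc, hd, hle', hcn, hdn⟩ := exists_shrinking hcd
  have hfc : ContinuousOn f (Ioo a b ×ˢ Ioo c d) := fun z hz =>
    (Hf z hz).continuousAt.continuousWithinAt
  have hgc' : ContinuousOn g (Ioo a b ×ˢ Ioo c d) := fun z hz =>
    (Hg z hz).continuousAt.continuousWithinAt
  have anb : ∀ n, an n ∈ Ioo a b := fun n => ⟨ha n, (hle n).trans_lt (hb n)⟩
  have bnb : ∀ n, bn n ∈ Ioo a b := fun n => ⟨(ha n).trans_le (hle n), hb n⟩
  have cnd : ∀ n, cn n ∈ Ioo c d := fun n => ⟨hc n, (hle' n).trans_lt (hd n)⟩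
  have dnd : ∀ n, dn n ∈ Ioo c d := fun n => ⟨(hc n).trans_le (hle' n), hd n⟩
  have hsub : ∀ n, Icc (an n) (bn n) ×ˢ Icc (cn n) (dn n) ⊆ Ioo a b ×ˢ Ioo c d := fun n =>
    Set.prod_mono (Icc_subset_Ioo (ha n) (hb n)) (Icc_subset_Ioo (hc n) (hd n))
  have hin := fun n => integral2_divergence_prod_of_hasFDerivAt_off_countable f g f' g'
    (an n) (cn n) (bn n) (dn n) ∅ countable_empty
    (by rw [uIcc_of_le (hle n), uIcc_of_le (hle' n)]; exact hfc.mono (hsub n))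
    (by rw [uIcc_of_le (hle n), uIcc_of_le (hle' n)]; exact hgc'.mono (hsub n))
    (by
      rw [min_eq_left (hle n), max_eq_right (hle n), min_eq_left (hle' n), max_eq_right (hle' n)]
      exact fun z hz => Hf z (hsub n (Set.prod_mono Ioo_subset_Icc_self Ioo_subset_Icc_self hz.1)))
    (by
      rw [min_eq_left (hle n), max_eq_right (hle n), min_eq_left (hle' n), max_eq_right (hle' n)]
      exact fun z hz => Hg z (hsub n (Set.prod_mono Ioo_subset_Icc_self Ioo_subset_Icc_self hz.1)))
    (by rw [uIcc_of_le (hle n), uIcc_of_le (hle' n)]; exact Hi.mono_set (hsub n))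
  have hsub' : ∀ n, Ioc (an n) (bn n) ×ˢ Ioc (cn n) (dn n) ⊆ Ioo a b ×ˢ Ioo c d := fun n =>
    (Set.prod_mono Ioc_subset_Icc_self Ioc_subset_Icc_self).trans (hsub n)
  have hlhs : Tendsto (fun n => ∫ x in (an n)..(bn n), ∫ y in (cn n)..(dn n),
      (f' (x, y) (1, 0) + g' (x, y) (0, 1))) atTop
      (𝓝 (∫ z in Ioo a b ×ˢ Ioo c d, (f' z (1, 0) + g' z (0, 1)))) := by
    have ht := tendsto_setIntegral_exhaustion (measurableSet_Ioo.prod measurableSet_Ioo)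
      (fun n => measurableSet_Ioc.prod measurableSet_Ioc) hsub' (fun z hz => by
        filter_upwards [han.eventually_lt_const hz.1.1, hbn.eventually_const_lt hz.1.2,
          hcn.eventually_lt_const hz.2.1, hdn.eventually_const_lt hz.2.2] with n h1 h2 h3 h4
        exact ⟨⟨h1, h2.le⟩, ⟨h3, h4.le⟩⟩) Hi
    refine ht.congr fun n => ?_
    rw [Measure.volume_eq_prod, setIntegral_prod _ (Hi.mono_set (hsub' n)),
      intervalIntegral.integral_of_le (hle n)]
    simp only [intervalIntegral.integral_of_le (hle' n)]
  have slice : ∀ x ∈ Ioo a b, ContinuousOn (fun y => f (x, y)) (Ioo c d) := fun x hx =>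
    hfc.comp (Continuous.prodMk_right x).continuousOn fun y hy => ⟨hx, hy⟩
  have slice' : ∀ y ∈ Ioo c d, ContinuousOn (fun x => g (x, y)) (Ioo a b) := fun y hy =>
    hgc'.comp (Continuous.prodMk_left y).continuousOn fun x hx => ⟨hx, hy⟩
  have wa : Tendsto an atTop (𝓝[>] a) :=
    tendsto_nhdsWithin_iff.2 ⟨han, Eventually.of_forall ha⟩
  have wb : Tendsto bn atTop (𝓝[<] b) :=
    tendsto_nhdsWithin_iff.2 ⟨hbn, Eventually.of_forall hb⟩
  have wc : Tendsto cn atTop (𝓝[>] c) :=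
    tendsto_nhdsWithin_iff.2 ⟨hcn, Eventually.of_forall hc⟩
  have wd : Tendsto dn atTop (𝓝[<] d) :=
    tendsto_nhdsWithin_iff.2 ⟨hdn, Eventually.of_forall hd⟩
  have e1 := tendsto_integral_edge hab ha hb hle han hbn (fun n => slice' _ (dnd n)) hh
    (fun n x hx => hgh (x, dn n) ⟨hx, dnd n⟩) fun x hx => (hgd x hx).comp wd
  have e2 := tendsto_integral_edge hab ha hb hle han hbn (fun n => slice' _ (cnd n)) hh
    (fun n x hx => hgh (x, cn n) ⟨hx, cnd n⟩) fun x hx => (hgc x hx).comp wc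
  have e3 := tendsto_integral_edge hcd hc hd hle' hcn hdn (fun n => slice _ (bnb n)) hk
    (fun n y hy => hfk (bn n, y) ⟨bnb n, hy⟩) fun y hy => (hfb y hy).comp wb
  have e4 := tendsto_integral_edge hcd hc hd hle' hcn hdn (fun n => slice _ (anb n)) hk
    (fun n y hy => hfk (an n, y) ⟨anb n, hy⟩) fun y hy => (hfa y hy).comp wa
  exact tendsto_nhds_unique hlhs
    ((((e1.sub e2).add e3).sub e4).congr fun n => (hin n).symm)

/-! ### Uniform bounds near a fixed time -/

/-- Bounds on the free surface, uniform for times in `closedBall t₀ δ`. -/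
structure SurfaceBounds (p : Params) (J : Set ℝ) (ρ : ℝ → ℝ → ℝ) (t₀ δ m M : ℝ) : Prop where
  δ_pos : 0 < δ
  m_pos : 0 < m
  ball : Metric.closedBall t₀ δ ⊆ J
  lower : ∀ t ∈ Metric.closedBall t₀ δ, ∀ θ ∈ Icc p.lo p.hi, m ≤ ρ t θ
  upper : ∀ t ∈ Metric.closedBall t₀ δ, ∀ θ ∈ Icc p.lo p.hi, ρ t θ ≤ M
  dTheta_le : ∀ t ∈ Metric.closedBall t₀ δ, ∀ θ ∈ Icc p.lo p.hi, |dTheta p (ρ t) θ| ≤ M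
  deriv_le : ∀ t ∈ Metric.closedBall t₀ δ, ∀ θ ∈ Icc p.lo p.hi, |deriv (fun s => ρ s θ) t| ≤ M

lemma exists_bound_slab {p : Params} {J : Set ℝ} {t₀ δ : ℝ} (hb : Metric.closedBall t₀ δ ⊆ J)
    {f : ℝ × ℝ → ℝ} (hf : ContinuousOn f (J ×ˢ Icc p.lo p.hi)) :
    ∃ M, ∀ t ∈ Metric.closedBall t₀ δ, ∀ θ ∈ Icc p.lo p.hi, |f (t, θ)| ≤ M := by
  have hK : IsCompact (Metric.closedBall t₀ δ ×ˢ Icc p.lo p.hi) :=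
    (isCompact_closedBall _ _).prod isCompact_Icc
  obtain ⟨M, hM⟩ := hK.exists_bound_of_continuousOn (hf.mono (Set.prod_mono hb subset_rfl))
  exact ⟨M, fun t ht θ hθ => hM (t, θ) ⟨ht, hθ⟩⟩

lemma Regularity.exists_surfaceBounds {p : Params} {J : Set ℝ} {ρ : ℝ → ℝ → ℝ}
    {u : ℝ → Plane → Plane} {P : ℝ → Plane → ℝ} (h : Regularity p J ρ u P) (hJ : IsOpen J)
    {t₀ : ℝ} (ht₀ : t₀ ∈ J) {ε : ℝ} (hε : 0 < ε) :
    ∃ δ m M, δ < ε ∧ SurfaceBounds p J ρ t₀ δ m M := by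
  obtain ⟨δ₀, hδ₀, hb₀⟩ := Metric.isOpen_iff.1 hJ t₀ ht₀
  let δ := min δ₀ ε / 2
  have hmin : 0 < min δ₀ ε := lt_min hδ₀ hε
  have hδ : 0 < δ := half_pos hmin
  have hlt : δ < min δ₀ ε := half_lt_self hmin
  have hb : Metric.closedBall t₀ δ ⊆ J :=
    (Metric.closedBall_subset_ball (hlt.trans_le (min_le_left _ _))).trans hb₀
  have hK : IsCompact (Metric.closedBall t₀ δ ×ˢ Icc p.lo p.hi) :=
    (isCompact_closedBall _ _).prod isCompact_Icc
  have hne : (Metric.closedBall t₀ δ ×ˢ Icc p.lo p.hi).Nonempty :=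
    ⟨(t₀, p.lo), Metric.mem_closedBall_self hδ.le, left_mem_Icc.2 p.lo_lt_hi.le⟩
  obtain ⟨z, hz, hmin⟩ := hK.exists_isMinOn hne (h.ρ_cont.mono (Set.prod_mono hb subset_rfl))
  obtain ⟨M₁, h₁⟩ := exists_bound_slab hb h.ρ_cont
  obtain ⟨M₂, h₂⟩ := exists_bound_slab hb h.dρ_cont
  obtain ⟨M₃, h₃⟩ := exists_bound_slab hb h.ρ_time_cont
  refine ⟨δ, ρ z.1 z.2, max (max M₁ M₂) M₃, hlt.trans_le (min_le_right _ _), hδ,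
    h.ρ_pos _ (hb hz.1) _ hz.2, hb, fun t ht θ hθ => hmin (a := (t, θ)) ⟨ht, hθ⟩,
    fun t ht θ hθ => ?_, fun t ht θ hθ => ?_, fun t ht θ hθ => ?_⟩
  · exact (le_abs_self _).trans ((h₁ t ht θ hθ).trans (by simp))
  · exact (h₂ t ht θ hθ).trans (by simp)
  · exact (h₃ t ht θ hθ).trans (by simp)

/-- The integrable weight in the angle. -/
def angleWeight (p : Params) (e θ : ℝ) : ℝ := (θ - p.lo) ^ e + (p.hi - θ) ^ e

lemma integrableOn_angleWeight (p : Params) {e : ℝ} (he : -1 < e) :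
    IntegrableOn (angleWeight p e) (Ioo p.lo p.hi) := by
  have h1 := (intervalIntegral.intervalIntegrable_rpow' (a := p.lo - p.lo) (b := p.hi - p.lo)
    he).comp_sub_right p.lo
  have h2 := (intervalIntegral.intervalIntegrable_rpow' (a := p.hi - p.lo) (b := p.hi - p.hi)
    he).comp_sub_left p.hi
  simp only [sub_add_cancel, sub_sub_cancel] at h1 h2
  exact ((intervalIntegrable_iff_integrableOn_Ioo_of_le p.lo_lt_hi.le).1 h1).add
    ((intervalIntegrable_iff_integrableOn_Ioo_of_le p.lo_lt_hi.le).1 h2)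

lemma integrableOn_rpow_Ioo {e : ℝ} (he : -1 < e) :
    IntegrableOn (fun s : ℝ => s ^ e) (Ioo 0 1) :=
  (intervalIntegrable_iff_integrableOn_Ioo_of_le zero_le_one).1
    (intervalIntegral.intervalIntegrable_rpow' he)

lemma integrableOn_one_sub_rpow_Ioo {e : ℝ} (he : -1 < e) :
    IntegrableOn (fun s : ℝ => (1 - s) ^ e) (Ioo 0 1) := by
  have h2 := (intervalIntegral.intervalIntegrable_rpow' (a := 1 - 0) (b := 1 - 1)
    he).comp_sub_left 1
  simp only [sub_sub_cancel] at h2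
  exact (intervalIntegrable_iff_integrableOn_Ioo_of_le zero_le_one).1 h2

lemma angleWeight_nonneg (p : Params) (e : ℝ) {θ : ℝ} (hθ : θ ∈ Icc p.lo p.hi) :
    0 ≤ angleWeight p e θ :=
  add_nonneg (rpow_nonneg (sub_nonneg.2 hθ.1) _) (rpow_nonneg (sub_nonneg.2 hθ.2) _)

/-- Growth at the corners, expressed in the parameter cell and uniformly in time: the quantity
`G` is bounded by an integrable function of each of the two boundary variables. -/
structure CellGrowth (p : Params) (J : Set ℝ) (ρ : ℝ → ℝ → ℝ) (G : ℝ → Plane → ℝ)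
    (t₀ δ C e : ℝ) : Prop where
  C_nonneg : 0 ≤ C
  lt_e : -1 < e
  angle : ∀ t ∈ Metric.closedBall t₀ δ, ∀ z ∈ cell p,
    G t (scaledPolar (ρ t) z) ≤ C * (z.1 ^ e + angleWeight p e z.2)
  radial : ∀ t ∈ Metric.closedBall t₀ δ, ∀ z ∈ cell p,
    G t (scaledPolar (ρ t) z) ≤ C * (z.1 ^ e + (1 - z.1) ^ e)

/-- The quantity controlled by the growth assumption. -/
def growthQuantity (u : ℝ → Plane → Plane) (P : ℝ → Plane → ℝ) (t : ℝ) (x : Plane) : ℝ :=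
  ‖fderiv ℝ (u t) x‖ + ‖deriv (fun s => u s x) t‖ + |P t x|

lemma infDist_corners_rpow_le {p : Params} {ρ : ℝ → ℝ} {m M e : ℝ}
    (hd : DifferentiableOn ℝ ρ (Icc p.lo p.hi)) (hm : 0 < m)
    (hρ : ∀ θ ∈ Icc p.lo p.hi, m ≤ ρ θ) (hM : ∀ θ ∈ Icc p.lo p.hi, |dTheta p ρ θ| ≤ M)
    (he : e ≤ 0) {z : ℝ × ℝ} (hz : z ∈ cell p) :
    Metric.infDist (scaledPolar ρ z) (corners p ρ) ^ e
      ≤ (min m (min (m / π) (m / (1 + M * π / m)))) ^ e * (z.1 ^ e + angleWeight p e z.2) ∧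
    Metric.infDist (scaledPolar ρ z) (corners p ρ) ^ e
      ≤ (min m (min (m / π) (m / (1 + M * π / m)))) ^ e * (z.1 ^ e + (1 - z.1) ^ e) := by
  obtain ⟨s, θ⟩ := z
  obtain ⟨hs, hθ⟩ := hz
  simp only at hs hθ ⊢
  have hM0 : 0 ≤ M := (abs_nonneg _).trans (hM p.lo (left_mem_Icc.2 p.lo_lt_hi.le))
  have hp := pi_pos
  set c := min m (min (m / π) (m / (1 + M * π / m))) with hc
  have hcpos : 0 < c := by positivity
  have hcm : c ≤ m := min_le_left _ _
  have hc1 : c ≤ m / π := (min_le_right _ _).trans (min_le_left _ _)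
  have hc2 : c ≤ m / (1 + M * π / m) := (min_le_right _ _).trans (min_le_right _ _)
  have hs0 := hs.1
  have hs1 : 0 < 1 - s := sub_pos.2 hs.2
  have hl : 0 < θ - p.lo := sub_pos.2 hθ.1
  have hh : 0 < p.hi - θ := sub_pos.2 hθ.2
  have key : ∀ {d a : ℝ}, 0 < a → c * a ≤ d → d ^ e ≤ c ^ e * a ^ e := fun ha h => by
    rw [← mul_rpow hcpos.le ha.le]
    exact rpow_le_rpow_of_nonpos (mul_pos hcpos ha) h he
  have hcn := rpow_nonneg hcpos.le e
  have ns := rpow_nonneg hs0.le e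
  have n1 := rpow_nonneg hs1.le e
  have nl := rpow_nonneg hl.le e
  have nh := rpow_nonneg hh.le e
  have hcont : ∀ φ ∈ Icc p.lo p.hi, 0 < |θ - φ| →
      ‖scaledPolar ρ (s, θ) - ρ φ • eR φ‖ ^ e ≤ c ^ e * |θ - φ| ^ e ∧
      ‖scaledPolar ρ (s, θ) - ρ φ • eR φ‖ ^ e ≤ c ^ e * (1 - s) ^ e := by
    intro φ hφ hne
    obtain ⟨h1, h2⟩ := contact_dist p hd hm hρ hM (Ioo_subset_Icc_self hs)
      (Ioo_subset_Icc_self hθ) hφ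
    exact ⟨key hne ((mul_le_mul_of_nonneg_right hc1 hne.le).trans h1),
      key hs1 ((mul_le_mul_of_nonneg_right hc2 hs1.le).trans h2)⟩
  have hfin : (corners p ρ).Finite := by
    unfold corners; exact toFinite _
  obtain ⟨y, hy, hdist⟩ := hfin.isCompact.exists_infDist_eq_dist
    (show (corners p ρ).Nonempty from ⟨0, by simp [corners]⟩) (scaledPolar ρ (s, θ))
  rw [hdist, dist_eq_norm]
  unfold angleWeight
  simp only [corners, mem_insert_iff, mem_singleton_iff] at hy
  rcases hy with rfl | rfl | rfl
  · have hr := hρ θ (Ioo_subset_Icc_self hθ)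
    have : c * s ≤ ‖scaledPolar ρ (s, θ) - 0‖ := by
      rw [sub_zero, scaledPolar, norm_smul, norm_eR, mul_one, norm_eq_abs]
      refine le_trans ?_ (le_abs_self _)
      simp only
      nlinarith
    have h := key hs0 this
    constructor <;> refine h.trans ?_ <;> gcongr <;> linarith
  · have h := hcont p.lo (left_mem_Icc.2 p.lo_lt_hi.le) (by rw [abs_of_pos hl]; exact hl)
    rw [abs_of_pos hl] at h
    constructor
    · refine h.1.trans ?_
      gcongr; linarith
    · refine h.2.trans ?_
      gcongr; linarith
  · have h := hcont p.hi (right_mem_Icc.2 p.lo_lt_hi.le)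
      (by rw [abs_sub_comm, abs_of_pos hh]; exact hh)
    rw [abs_sub_comm, abs_of_pos hh] at h
    constructor
    · refine h.1.trans ?_
      gcongr; linarith
    · refine h.2.trans ?_
      gcongr; linarith

lemma scaledPolar_mem_fluidDomain {p : Params} {ρ : ℝ → ℝ}
    (hρ : ∀ θ ∈ Icc p.lo p.hi, 0 < ρ θ) {z : ℝ × ℝ} (hz : z ∈ cell p) :
    scaledPolar ρ z ∈ fluidDomain p ρ := by
  rw [fluidDomain_eq_image p hρ]
  exact mem_image_of_mem _ hz

lemma Regularity.exists_cellGrowth {p : Params} {J : Set ℝ} {ρ : ℝ → ℝ → ℝ}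
    {u : ℝ → Plane → Plane} {P : ℝ → Plane → ℝ} (h : Regularity p J ρ u P) (hJ : IsOpen J)
    {t₀ : ℝ} (ht₀ : t₀ ∈ J) :
    ∃ δ m M C e, SurfaceBounds p J ρ t₀ δ m M ∧
      CellGrowth p J ρ (growthQuantity u P) t₀ δ C e := by
  obtain ⟨C, l, ε, hl, hε, hg⟩ := h.growth t₀ ht₀
  obtain ⟨δ, m, M, hδε, hb⟩ := h.exists_surfaceBounds hJ ht₀ hε
  have hM0 : 0 ≤ M := (abs_nonneg _).trans (hb.dTheta_le t₀ (Metric.mem_closedBall_self hb.δ_pos.le)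
    p.lo (left_mem_Icc.2 p.lo_lt_hi.le))
  have hp := pi_pos
  have hm := hb.m_pos
  have hg' : ∀ t ∈ Metric.closedBall t₀ δ, ∀ z ∈ cell p, growthQuantity u P t (scaledPolar (ρ t) z)
      ≤ max C 0 * Metric.infDist (scaledPolar (ρ t) z) (corners p (ρ t)) ^ (l - 1) := by
    intro t ht z hz
    refine (hg t (hb.ball ht) (lt_of_le_of_lt ?_ hδε) _
      (scaledPolar_mem_fluidDomain (h.ρ_pos t (hb.ball ht)) hz)).trans ?_
    · simpa [dist_eq_norm] using ht
    · exact mul_le_mul_of_nonneg_right (le_max_left _ _) (rpow_nonneg Metric.infDist_nonneg _)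
  have hC0 : 0 ≤ max C 0 := le_max_right _ _
  rcases lt_or_ge l 1 with hl1 | hl1
  · have key := fun t (ht : t ∈ Metric.closedBall t₀ δ) z (hz : z ∈ cell p) =>
      infDist_corners_rpow_le (h.ρ_diff t (hb.ball ht)) hm (hb.lower t ht) (hb.dTheta_le t ht)
        (show l - 1 ≤ 0 by linarith) hz
    refine ⟨δ, m, M, max C 0 * (min m (min (m / π) (m / (1 + M * π / m)))) ^ (l - 1), l - 1, hb,
      by positivity, by linarith, fun t ht z hz => ?_, fun t ht z hz => ?_⟩
    · rw [mul_assoc]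
      exact (hg' t ht z hz).trans (mul_le_mul_of_nonneg_left (key t ht z hz).1 hC0)
    · rw [mul_assoc]
      exact (hg' t ht z hz).trans (mul_le_mul_of_nonneg_left (key t ht z hz).2 hC0)
  · have key : ∀ t ∈ Metric.closedBall t₀ δ, ∀ z ∈ cell p,
        growthQuantity u P t (scaledPolar (ρ t) z) ≤ max C 0 * M ^ (l - 1) * 1 := by
      intro t ht z hz
      rw [mul_one]
      refine (hg' t ht z hz).trans (mul_le_mul_of_nonneg_left ?_ hC0)
      refine rpow_le_rpow Metric.infDist_nonneg ?_ (by linarith)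
      refine (Metric.infDist_le_dist_of_mem (show (0 : Plane) ∈ corners p (ρ t) by
        simp [corners])).trans ?_
      rw [dist_zero_right, scaledPolar, norm_smul, norm_eR, mul_one, norm_eq_abs]
      have h1 := hb.lower t ht z.2 (Ioo_subset_Icc_self hz.2)
      have h2 := hb.upper t ht z.2 (Ioo_subset_Icc_self hz.2)
      have h3 : 0 < z.1 := hz.1.1
      have h4 : z.1 < 1 := hz.1.2
      rw [abs_of_nonneg (by apply mul_nonneg <;> linarith)]
      nlinarith
    have hone : ∀ z ∈ cell p, 1 ≤ z.1 ^ (-1 / 2 : ℝ) := fun z hz =>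
      one_le_rpow_of_pos_of_le_one_of_nonpos hz.1.1 hz.1.2.le (by norm_num)
    refine ⟨δ, m, M, max C 0 * M ^ (l - 1), -1 / 2, hb, by positivity, by norm_num,
      fun t ht z hz => ?_, fun t ht z hz => ?_⟩
    · refine (key t ht z hz).trans (mul_le_mul_of_nonneg_left ?_ (by positivity))
      linarith [hone z hz, angleWeight_nonneg p (-1 / 2) (Ioo_subset_Icc_self hz.2)]
    · refine (key t ht z hz).trans (mul_le_mul_of_nonneg_left ?_ (by positivity))
      linarith [hone z hz, rpow_nonneg (sub_nonneg.2 hz.1.2.le) (-1 / 2 : ℝ)]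

/-! ### The surface energy -/

lemma hasDerivAt_integral_slab {J : Set ℝ} (hJ : IsOpen J) {a b : ℝ} (hab : a ≤ b)
    {f f' : ℝ → ℝ → ℝ} (hf : ContinuousOn (fun z : ℝ × ℝ => f z.1 z.2) (J ×ˢ Icc a b))
    (hf' : ContinuousOn (fun z : ℝ × ℝ => f' z.1 z.2) (J ×ˢ Icc a b))
    (hd : ∀ τ ∈ J, ∀ θ ∈ Icc a b, HasDerivAt (fun s => f s θ) (f' τ θ) τ) {t : ℝ} (ht : t ∈ J) :
    HasDerivAt (fun τ => ∫ θ in a..b, f τ θ) (∫ θ in a..b, f' t θ) t := by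
  obtain ⟨δ, hδ, hb⟩ := Metric.nhds_basis_closedBall.mem_iff.1 (hJ.mem_nhds ht)
  have hK : IsCompact (Metric.closedBall t δ ×ˢ Icc a b) :=
    (isCompact_closedBall _ _).prod isCompact_Icc
  obtain ⟨M, hM⟩ := hK.exists_bound_of_continuousOn (hf'.mono (Set.prod_mono hb subset_rfl))
  have slice : ∀ {g : ℝ → ℝ → ℝ}, ContinuousOn (fun z : ℝ × ℝ => g z.1 z.2) (J ×ˢ Icc a b) →
      ∀ τ ∈ J, ContinuousOn (g τ) (Icc a b) := fun hg τ hτ =>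
    hg.comp (Continuous.prodMk_right τ).continuousOn fun _ hy => ⟨hτ, hy⟩
  have hu : uIoc a b ⊆ Icc a b := by rw [uIoc_of_le hab]; exact Ioc_subset_Icc_self
  refine (intervalIntegral.hasDerivAt_integral_of_dominated_loc_of_deriv_le (bound := fun _ => M)
    (F' := f') (Metric.closedBall_mem_nhds t hδ) ?_ ?_ ?_ ?_ ?_ ?_).2
  · filter_upwards [hJ.mem_nhds ht] with τ hτ
    exact ((slice hf τ hτ).mono hu).aestronglyMeasurable measurableSet_uIoc
  · exact ContinuousOn.intervalIntegrable (by rw [uIcc_of_le hab]; exact slice hf t ht)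
  · exact ((slice hf' t ht).mono hu).aestronglyMeasurable measurableSet_uIoc
  · exact ae_of_all _ fun θ hθ τ hτ => hM (τ, θ) ⟨hτ, hu hθ⟩
  · exact intervalIntegrable_const
  · exact ae_of_all _ fun θ hθ τ hτ => hd τ (hb hτ) θ (hu hθ)

section Surface

variable {p : Params} {J : Set ℝ} {ρ : ℝ → ℝ → ℝ} {u : ℝ → Plane → Plane} {P : ℝ → Plane → ℝ}

lemma continuousOn_slab_slice {f : ℝ → ℝ → ℝ}
    (hf : ContinuousOn (fun z : ℝ × ℝ => f z.1 z.2) (J ×ˢ Icc p.lo p.hi)) {t : ℝ} (ht : t ∈ J) :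
    ContinuousOn (f t) (Icc p.lo p.hi) :=
  hf.comp (Continuous.prodMk_right t).continuousOn fun _ hy => ⟨ht, hy⟩

lemma Regularity.continuousOn_dTheta (h : Regularity p J ρ u P) {t : ℝ} (ht : t ∈ J) :
    ContinuousOn (dTheta p (ρ t)) (Icc p.lo p.hi) :=
  continuousOn_slab_slice (f := fun τ => dTheta p (ρ τ)) h.dρ_cont ht

lemma Regularity.continuousOn_time_deriv (h : Regularity p J ρ u P) {t : ℝ} (ht : t ∈ J) :
    ContinuousOn (fun θ => deriv (fun s => ρ s θ) t) (Icc p.lo p.hi) :=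
  continuousOn_slab_slice (f := fun τ θ => deriv (fun s => ρ s θ) τ) h.ρ_time_cont ht

lemma Regularity.continuousOn_mixed_deriv (h : Regularity p J ρ u P) {t : ℝ} (ht : t ∈ J) :
    ContinuousOn (fun θ => deriv (fun s => dTheta p (ρ s) θ) t) (Icc p.lo p.hi) :=
  continuousOn_slab_slice (f := fun τ θ => deriv (fun s => dTheta p (ρ s) θ) τ) h.dρ_time_cont ht

/-- The time derivative of the free surface is differentiable in the angle, with the mixed
derivative as its derivative. -/
lemma Regularity.hasDerivAt_time_deriv (h : Regularity p J ρ u P) (hJ : IsOpen J) {t : ℝ}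
    (ht : t ∈ J) {θ : ℝ} (hθ : θ ∈ Ioo p.lo p.hi) :
    HasDerivAt (fun φ => deriv (fun s => ρ s φ) t) (deriv (fun s => dTheta p (ρ s) θ) t) θ := by
  have hcm := h.continuousOn_mixed_deriv ht
  have hlo : p.lo ∈ Icc p.lo p.hi := left_mem_Icc.2 p.lo_lt_hi.le
  have hrep : ∀ φ ∈ Icc p.lo p.hi, deriv (fun s => ρ s φ) t
      = deriv (fun s => ρ s p.lo) t + ∫ x in p.lo..φ, deriv (fun s => dTheta p (ρ s) x) t := by
    intro φ hφ
    have hsub : Icc p.lo φ ⊆ Icc p.lo p.hi := Icc_subset_Icc_right hφ.2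
    have h1 := hasDerivAt_integral_slab hJ hφ.1 (f := fun τ x => dTheta p (ρ τ) x)
      (f' := fun τ x => deriv (fun s => dTheta p (ρ s) x) τ)
      (h.dρ_cont.mono (Set.prod_mono subset_rfl hsub))
      (h.dρ_time_cont.mono (Set.prod_mono subset_rfl hsub))
      (fun τ hτ x hx => (h.dρ_time_diff τ hτ x (hsub hx)).hasDerivAt) ht
    have h2 := h1.add (h.ρ_time_diff t ht p.lo hlo).hasDerivAt
    have h3 : HasDerivAt (fun s => ρ s φ) _ t := h2.congr_of_eventuallyEq <| by
      filter_upwards [hJ.mem_nhds ht] with τ hτ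
      have := intervalIntegral.integral_eq_sub_of_hasDerivAt_of_le hφ.1
        (f := ρ τ) (f' := dTheta p (ρ τ)) ((h.ρ_diff τ hτ).continuousOn.mono hsub)
        (fun x hx => hasDerivAt_of_differentiableOn p (h.ρ_diff τ hτ)
          ⟨hx.1, hx.2.trans_le hφ.2⟩)
        (ContinuousOn.intervalIntegrable
          (by rw [uIcc_of_le hφ.1]; exact (h.continuousOn_dTheta hτ).mono hsub))
      simp [this]
    rw [h3.deriv, add_comm]
  have hint : HasDerivAt (fun φ => ∫ x in p.lo..φ, deriv (fun s => dTheta p (ρ s) x) t)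
      (deriv (fun s => dTheta p (ρ s) θ) t) θ := by
    have hn := Icc_mem_nhds hθ.1 hθ.2
    refine intervalIntegral.integral_hasDerivAt_right
      (ContinuousOn.intervalIntegrable ?_) ?_ (hcm.continuousAt hn)
    · rw [uIcc_of_le hθ.1.le]
      exact hcm.mono (Icc_subset_Icc_right hθ.2.le)
    · exact (hcm.mono Ioo_subset_Icc_self).stronglyMeasurableAtFilter isOpen_Ioo _ hθ
  refine ((hint.const_add (deriv (fun s => ρ s p.lo) t)).congr_of_eventuallyEq ?_)
  filter_upwards [Icc_mem_nhds hθ.1 hθ.2] with φ hφ using hrep φ hφ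

lemma arcDensity_pos {ρ : ℝ → ℝ} {θ : ℝ} (h : 0 < ρ θ) : 0 < arcDensity p ρ θ := by
  unfold arcDensity; positivity

lemma Regularity.continuousOn_arcDensity (h : Regularity p J ρ u P) :
    ContinuousOn (fun z : ℝ × ℝ => arcDensity p (ρ z.1) z.2) (J ×ˢ Icc p.lo p.hi) :=
  ((h.ρ_cont.pow 2).add (h.dρ_cont.pow 2)).sqrt

lemma Regularity.hasDerivAt_arcDensity (h : Regularity p J ρ u P) {t θ : ℝ} (ht : t ∈ J)
    (hθ : θ ∈ Icc p.lo p.hi) :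
    HasDerivAt (fun s => arcDensity p (ρ s) θ)
      ((ρ t θ * deriv (fun s => ρ s θ) t
        + dTheta p (ρ t) θ * deriv (fun s => dTheta p (ρ s) θ) t) / arcDensity p (ρ t) θ) t := by
  have hpos := h.ρ_pos t ht θ hθ
  have h1 := (((h.ρ_time_diff t ht θ hθ).hasDerivAt.pow 2).add
    ((h.dρ_time_diff t ht θ hθ).hasDerivAt.pow 2)).sqrt (by simp only [Pi.add_apply, Pi.pow_apply]; positivity)
  refine h1.congr_deriv ?_
  have := arcDensity_pos (p := p) hpos
  simp only [arcDensity, Pi.add_apply, Pi.pow_apply] at this ⊢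
  field_simp
  ring

/-- The normal stress `g ρ sin θ - σ H(ρ)` of the free surface. -/
def normalStress (p : Params) (ρ : ℝ → ℝ) (θ : ℝ) : ℝ :=
  p.g * ρ θ * sin θ - p.σ * meanCurv p ρ θ

lemma Regularity.differentiableAt_slope (h : Regularity p J ρ u P) {t θ : ℝ} (ht : t ∈ J)
    (hθ : θ ∈ Ioo p.lo p.hi) :
    DifferentiableAt ℝ (dTheta p (ρ t)) θ := by
  have h1 : ContDiffOn ℝ 1 (deriv (ρ t)) (Ioo p.lo p.hi) :=
    (h.ρ_contDiff t ht).deriv_of_isOpen isOpen_Ioo (by norm_num)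
  have h2 : DifferentiableAt ℝ (deriv (ρ t)) θ :=
    (h1.contDiffAt (Ioo_mem_nhds hθ.1 hθ.2)).differentiableAt one_ne_zero
  refine h2.congr_of_eventuallyEq ?_
  filter_upwards [Ioo_mem_nhds hθ.1 hθ.2] with φ hφ
  exact derivWithin_of_mem_nhds (Icc_mem_nhds hφ.1 hφ.2)

lemma Regularity.differentiableAt_unit_slope (h : Regularity p J ρ u P) {t θ : ℝ} (ht : t ∈ J)
    (hθ : θ ∈ Ioo p.lo p.hi) :
    DifferentiableAt ℝ (fun φ => dTheta p (ρ t) φ / arcDensity p (ρ t) φ) θ := by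
  have hpos := h.ρ_pos t ht θ (Ioo_subset_Icc_self hθ)
  have h1 := h.differentiableAt_slope ht hθ
  have h2 := (hasDerivAt_of_differentiableOn p (h.ρ_diff t ht) hθ).differentiableAt
  refine h1.div (((h2.pow 2).add (h1.pow 2)).sqrt ?_) (arcDensity_pos hpos).ne'
  simp only [Pi.add_apply, Pi.pow_apply]
  positivity

theorem IsSolution.hasDerivAt_surfaceEnergy (hsol : IsSolution p J ρ u P) (hJ : IsOpen J) {t : ℝ}
    (ht : t ∈ J) (hκ : IntegrableOn (normalStress p (ρ t)) (Ioo p.lo p.hi)) :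
    HasDerivAt (fun τ => surfaceEnergy p (ρ τ))
      ((∫ θ in p.lo..p.hi, normalStress p (ρ t) θ * (ρ t θ * deriv (fun s => ρ s θ) t))
        - deriv (fun s => ρ s p.hi) t * p.W (deriv (fun s => ρ s p.hi) t)
        - deriv (fun s => ρ s p.lo) t * p.W (deriv (fun s => ρ s p.lo) t)) t := by
  have h := hsol.regularity
  have hle := p.lo_lt_hi.le
  have hlo : p.lo ∈ Icc p.lo p.hi := left_mem_Icc.2 hle
  have hhi : p.hi ∈ Icc p.lo p.hi := right_mem_Icc.2 hle
  have hu := uIcc_of_le hle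
  set rt : ℝ → ℝ := fun θ => deriv (fun s => ρ s θ) t with hrt
  set mt : ℝ → ℝ := fun θ => deriv (fun s => dTheta p (ρ s) θ) t with hmt
  set a : ℝ → ℝ := arcDensity p (ρ t) with ha
  set r' : ℝ → ℝ := dTheta p (ρ t) with hr'
  have hapos : ∀ θ ∈ Icc p.lo p.hi, 0 < a θ := fun θ hθ => arcDensity_pos (h.ρ_pos t ht θ hθ)
  have cρ : ContinuousOn (ρ t) (Icc p.lo p.hi) := (h.ρ_diff t ht).continuousOn
  have cr' : ContinuousOn r' (Icc p.lo p.hi) := h.continuousOn_dTheta ht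
  have crt : ContinuousOn rt (Icc p.lo p.hi) := h.continuousOn_time_deriv ht
  have cmt : ContinuousOn mt (Icc p.lo p.hi) := h.continuousOn_mixed_deriv ht
  have ca : ContinuousOn a (Icc p.lo p.hi) :=
    continuousOn_slab_slice (f := fun τ => arcDensity p (ρ τ)) h.continuousOn_arcDensity ht
  have ii : ∀ {f : ℝ → ℝ}, ContinuousOn f (Icc p.lo p.hi) →
      IntervalIntegrable f volume p.lo p.hi := fun hf =>
    ContinuousOn.intervalIntegrable (by rwa [hu])
  have d1 := hasDerivAt_integral_slab hJ hle (f := fun τ θ => ρ τ θ ^ 3 * sin θ)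
    (f' := fun τ θ => 3 * ρ τ θ ^ 2 * deriv (fun s => ρ s θ) τ * sin θ)
    ((h.ρ_cont.pow 3).mul (continuous_sin.comp continuous_snd).continuousOn)
    (((continuousOn_const.mul (h.ρ_cont.pow 2)).mul h.ρ_time_cont).mul
      (continuous_sin.comp continuous_snd).continuousOn)
    (fun τ hτ θ hθ => by
      simpa using ((h.ρ_time_diff τ hτ θ hθ).hasDerivAt.pow 3).mul_const (sin θ)) ht
  have d2 := hasDerivAt_integral_slab hJ hle (f := fun τ θ => arcDensity p (ρ τ) θ)
    (f' := fun τ θ => (ρ τ θ * deriv (fun s => ρ s θ) τ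
        + dTheta p (ρ τ) θ * deriv (fun s => dTheta p (ρ s) θ) τ) / arcDensity p (ρ τ) θ)
    h.continuousOn_arcDensity
    (((h.ρ_cont.mul h.ρ_time_cont).add (h.dρ_cont.mul h.dρ_time_cont)).div
      h.continuousOn_arcDensity fun z hz => (arcDensity_pos (h.ρ_pos z.1 hz.1 z.2 hz.2)).ne')
    (fun τ hτ θ hθ => h.hasDerivAt_arcDensity hτ hθ) ht
  have d3 := ((h.ρ_time_diff t ht _ hhi).hasDerivAt.add
    (h.ρ_time_diff t ht _ hlo).hasDerivAt).const_mul p.jump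
  have dall := ((d1.const_mul (p.g / 3)).add (d2.const_mul p.σ)).sub d3
  refine dall.congr_deriv ?_
  have hcurv : ∀ θ ∈ Ioo p.lo p.hi, deriv (fun φ => r' φ / a φ) θ
      = ρ t θ * ((p.g * ρ t θ * sin θ - normalStress p (ρ t) θ) / p.σ) + ρ t θ / a θ := by
    intro θ hθ
    have h1 := h.ρ_pos t ht θ (Ioo_subset_Icc_self hθ)
    have h2 := p.σ_pos
    simp only [normalStress, meanCurv, ← ha, ← hr']
    field_simp
    ring
  have hκi : IntervalIntegrable (normalStress p (ρ t)) volume p.lo p.hi :=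
    (intervalIntegrable_iff_integrableOn_Ioo_of_le hle).2 hκ
  have hrhs : IntervalIntegrable (fun θ => ρ t θ *
      ((p.g * ρ t θ * sin θ - normalStress p (ρ t) θ) / p.σ) + ρ t θ / a θ) volume p.lo p.hi := by
    refine IntervalIntegrable.add (IntervalIntegrable.continuousOn_mul
      (((ii ((continuousOn_const.mul cρ).mul continuous_sin.continuousOn)).sub hκi).div_const _)
      (by rwa [hu])) (ii (cρ.div ca fun θ hθ => (hapos θ hθ).ne'))
  have hdi : IntervalIntegrable (deriv fun φ => r' φ / a φ) volume p.lo p.hi := by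
    rw [intervalIntegrable_iff_integrableOn_Ioo_of_le hle] at hrhs ⊢
    exact hrhs.congr_fun (fun θ hθ => (hcurv θ hθ).symm) measurableSet_Ioo
  have ibp := intervalIntegral.integral_mul_deriv_eq_deriv_mul_of_hasDerivAt
    (u := fun φ => r' φ / a φ) (v := rt) (u' := deriv fun φ => r' φ / a φ) (v' := mt)
    (by rw [hu]; exact cr'.div ca fun θ hθ => (hapos θ hθ).ne') (by rwa [hu])
    (by
      rw [min_eq_left hle, max_eq_right hle]
      exact fun θ hθ => (h.differentiableAt_unit_slope ht hθ).hasDerivAt)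
    (by
      rw [min_eq_left hle, max_eq_right hle]
      exact fun θ hθ => h.hasDerivAt_time_deriv hJ ht hθ) hdi (ii cmt)
  have hsplit : ∫ θ in p.lo..p.hi, (ρ t θ * rt θ + r' θ * mt θ) / a θ
      = (∫ θ in p.lo..p.hi, ρ t θ * rt θ / a θ) + ∫ θ in p.lo..p.hi, r' θ / a θ * mt θ := by
    rw [← intervalIntegral.integral_add]
    · congr 1; ext θ; ring
    · exact ii ((cρ.mul crt).div ca fun θ hθ => (hapos θ hθ).ne')
    · exact ii ((cr'.div ca fun θ hθ => (hapos θ hθ).ne').mul cmt)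
  have hcomb : p.g / 3 * (∫ θ in p.lo..p.hi, 3 * ρ t θ ^ 2 * rt θ * sin θ)
      + p.σ * ((∫ θ in p.lo..p.hi, ρ t θ * rt θ / a θ)
        - ∫ θ in p.lo..p.hi, deriv (fun φ => r' φ / a φ) θ * rt θ)
      = ∫ θ in p.lo..p.hi, normalStress p (ρ t) θ * (ρ t θ * rt θ) := by
    have i1 : IntervalIntegrable (fun θ => 3 * ρ t θ ^ 2 * rt θ * sin θ) volume p.lo p.hi :=
      ii (((continuousOn_const.mul (cρ.pow 2)).mul crt).mul continuous_sin.continuousOn)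
    have i2 : IntervalIntegrable (fun θ => ρ t θ * rt θ / a θ) volume p.lo p.hi :=
      ii ((cρ.mul crt).div ca fun θ hθ => (hapos θ hθ).ne')
    have i3 : IntervalIntegrable (fun θ => deriv (fun φ => r' φ / a φ) θ * rt θ)
        volume p.lo p.hi := hdi.mul_continuousOn (by rwa [hu])
    rw [← intervalIntegral.integral_sub i2 i3, ← intervalIntegral.integral_const_mul,
      ← intervalIntegral.integral_const_mul,
      ← intervalIntegral.integral_add (i1.const_mul _) ((i2.sub i3).const_mul _)]
    rw [intervalIntegral.integral_of_le hle, intervalIntegral.integral_of_le hle,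
      integral_Ioc_eq_integral_Ioo, integral_Ioc_eq_integral_Ioo]
    refine setIntegral_congr_fun measurableSet_Ioo fun θ hθ => ?_
    have h2 := p.σ_pos
    have h3 := hapos θ (Ioo_subset_Icc_self hθ)
    rw [hcurv θ hθ]
    field_simp
    ring
  have w1 := hsol.contact_hi t ht
  have w2 := hsol.contact_lo t ht
  change p.W (rt p.hi) = p.jump - p.σ * (r' p.hi / a p.hi) at w1
  change p.W (rt p.lo) = p.jump + p.σ * (r' p.lo / a p.lo) at w2
  change p.g / 3 * (∫ θ in p.lo..p.hi, 3 * ρ t θ ^ 2 * rt θ * sin θ)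
      + p.σ * (∫ θ in p.lo..p.hi, (ρ t θ * rt θ + r' θ * mt θ) / a θ)
      - p.jump * (rt p.hi + rt p.lo)
    = (∫ θ in p.lo..p.hi, normalStress p (ρ t) θ * (ρ t θ * rt θ))
      - rt p.hi * p.W (rt p.hi) - rt p.lo * p.W (rt p.lo)
  rw [hsplit, ibp, w1, w2, ← hcomb]
  ring

end Surface

/-! ### The pulled-back flux and its divergence -/

lemma hasDerivAt_scaledPolar_radial (ρ : ℝ → ℝ) (s θ : ℝ) :
    HasDerivAt (fun r => scaledPolar ρ (r, θ)) (ρ θ • eR θ) s := by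
  have h := ((hasDerivAt_id s).mul_const (ρ θ)).smul_const (eR θ)
  rw [one_mul] at h
  exact h

lemma hasDerivAt_scaledPolar_angular {ρ : ℝ → ℝ} {r' θ : ℝ} (h : HasDerivAt ρ r' θ) (s : ℝ) :
    HasDerivAt (fun φ => scaledPolar ρ (s, φ)) ((s * r') • eR θ + (s * ρ θ) • ePhi θ) θ := by
  have := (h.const_mul s).smul (hasDerivAt_eR θ)
  rw [add_comm] at this
  exact this

lemma differentiableAt_scaledPolar {ρ : ℝ → ℝ} {z : ℝ × ℝ} (h : DifferentiableAt ℝ ρ z.2) :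
    DifferentiableAt ℝ (scaledPolar ρ) z := by
  have h1 : DifferentiableAt ℝ (fun z : ℝ × ℝ => ρ z.2) z :=
    DifferentiableAt.comp z h differentiableAt_snd
  have h2 : DifferentiableAt ℝ (fun z : ℝ × ℝ => eR z.2) z :=
    DifferentiableAt.comp (g := eR) z (hasDerivAt_eR z.2).differentiableAt differentiableAt_snd
  exact (differentiableAt_fst.mul h1).smul h2

lemma clm_plane_apply (L : Plane →L[ℝ] Plane) (v : Plane) :
    L v = v 0 • L (EuclideanSpace.single 0 1) + v 1 • L (EuclideanSpace.single 1 1) := by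
  have : v = v 0 • EuclideanSpace.single 0 1 + v 1 • EuclideanSpace.single 1 1 :=
    plane_ext (by simp) (by simp)
  conv_lhs => rw [this]
  simp only [map_add, map_smul]

lemma hasDerivAt_radial_component {ρ : ℝ → ℝ} {F : Plane → Plane} {s θ : ℝ} {n : Plane}
    (hF : DifferentiableAt ℝ F (scaledPolar ρ (s, θ))) :
    HasDerivAt (fun r => r * inner ℝ (F (scaledPolar ρ (r, θ))) n)
      (inner ℝ (F (scaledPolar ρ (s, θ))) n
        + s * inner ℝ (fderiv ℝ F (scaledPolar ρ (s, θ)) (ρ θ • eR θ)) n) s := by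
  have h1 := hF.hasFDerivAt.comp_hasDerivAt s (hasDerivAt_scaledPolar_radial ρ s θ)
  exact ((hasDerivAt_id s).mul (h1.inner ℝ (hasDerivAt_const s n))).congr_deriv (by simp)

lemma hasDerivAt_angular_component {ρ : ℝ → ℝ} {F : Plane → Plane} {s θ r' : ℝ}
    (h : HasDerivAt ρ r' θ) (hF : DifferentiableAt ℝ F (scaledPolar ρ (s, θ))) :
    HasDerivAt (fun φ => ρ φ * inner ℝ (F (scaledPolar ρ (s, φ))) (ePhi φ))
      (r' * inner ℝ (F (scaledPolar ρ (s, θ))) (ePhi θ)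
        + ρ θ * (-inner ℝ (F (scaledPolar ρ (s, θ))) (eR θ)
        + inner ℝ (fderiv ℝ F (scaledPolar ρ (s, θ)) ((s * r') • eR θ + (s * ρ θ) • ePhi θ))
          (ePhi θ))) θ := by
  have h1 := hF.hasFDerivAt.comp_hasDerivAt θ (hasDerivAt_scaledPolar_angular h s)
  exact (h.mul (h1.inner ℝ (hasDerivAt_ePhi θ))).congr_deriv (by simp)

lemma piola_identity (L : Plane →L[ℝ] Plane) (f : Plane) (s r r' θ : ℝ) :
    (inner ℝ f (r • eR θ - r' • ePhi θ) + s * inner ℝ (L (r • eR θ)) (r • eR θ - r' • ePhi θ))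
      + (r' * inner ℝ f (ePhi θ) + r * (-inner ℝ f (eR θ)
        + inner ℝ (L ((s * r') • eR θ + (s * r) • ePhi θ)) (ePhi θ)))
      = s * r ^ 2 * ∑ i, (L (EuclideanSpace.single i 1)) i := by
  rw [clm_plane_apply L (r • eR θ), clm_plane_apply L ((s * r') • eR θ + (s * r) • ePhi θ)]
  simp only [plane_inner, Fin.sum_univ_two, PiLp.add_apply, PiLp.sub_apply, PiLp.smul_apply,
    eR_zero, eR_one, ePhi_zero, ePhi_one, smul_eq_mul]
  linear_combination (s * r ^ 2 * ((L (EuclideanSpace.single 0 1)) 0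
    + (L (EuclideanSpace.single 1 1)) 1)) * cos_sq_add_sin_sq θ

/-- The energy flux `S(q, v) v + ½ |v|² v`. -/
def flux (visc : ℝ) (D : Set Plane) (q : Plane → ℝ) (v : Plane → Plane) (x : Plane) : Plane :=
  act (stress visc D q v x) (v x) + (1 / 2 * ‖v x‖ ^ 2) • v x

lemma act_apply (M : Matrix (Fin 2) (Fin 2) ℝ) (n : Plane) (i : Fin 2) :
    act M n i = M i 0 * n 0 + M i 1 * n 1 := by
  fin_cases i <;> simp [act]

lemma stress_apply (visc : ℝ) (D : Set Plane) (q : Plane → ℝ) (v : Plane → Plane) (x : Plane)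
    (i j : Fin 2) : stress visc D q v x i j
      = q x * (if i = j then 1 else 0)
        - visc * ((fderivWithin ℝ v D x (EuclideanSpace.single j 1)) i
          + (fderivWithin ℝ v D x (EuclideanSpace.single i 1)) j) := by
  simp [stress, symGrad, grad, Matrix.one_apply, mul_add]

lemma stress_symm (visc : ℝ) (D : Set Plane) (q : Plane → ℝ) (v : Plane → Plane) (x : Plane)
    (i j : Fin 2) : stress visc D q v x i j = stress visc D q v x j i := by
  simp only [stress_apply, eq_comm (a := i), add_comm]

lemma hasFDerivAt_plane_apply {v : Plane → Plane} {L : Plane →L[ℝ] Plane} {x : Plane}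
    (h : HasFDerivAt v L x) (i : Fin 2) :
    HasFDerivAt (fun y => v y i) ((EuclideanSpace.proj i : Plane →L[ℝ] ℝ).comp L) x :=
  (EuclideanSpace.proj i : Plane →L[ℝ] ℝ).hasFDerivAt.comp x h

lemma differentiableAt_plane {v : Plane → Plane} {x : Plane}
    (h : ∀ i, DifferentiableAt ℝ (fun y => v y i) x) : DifferentiableAt ℝ v x :=
  differentiableAt_euclidean.2 h

section Div

variable {Ω D : Set Plane} {q : Plane → ℝ} {v : Plane → Plane} {x : Plane}

lemma fderivWithin_of_isOpen_subset (hΩ : IsOpen Ω) (hD : Ω ⊆ D) (hx : x ∈ Ω) :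
    fderivWithin ℝ v D x = fderiv ℝ v x :=
  fderivWithin_of_mem_nhds (Filter.mem_of_superset (hΩ.mem_nhds hx) hD)

lemma differentiableAt_stress (visc : ℝ) (hΩ : IsOpen Ω) (hD : Ω ⊆ D) (hv : ContDiffOn ℝ 2 v Ω)
    (hq : ContDiffOn ℝ 1 q Ω) (hx : x ∈ Ω) (i j : Fin 2) :
    DifferentiableAt ℝ (fun y => stress visc D q v y i j) x := by
  have hdv : DifferentiableAt ℝ (fderiv ℝ v) x :=
    ((hv.fderiv_of_isOpen hΩ (m := 1) (by norm_num)).contDiffAt (hΩ.mem_nhds hx)).differentiableAt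
      one_ne_zero
  have hg : ∀ i j : Fin 2, DifferentiableAt ℝ
      (fun y => (fderivWithin ℝ v D y (EuclideanSpace.single j 1)) i) x := by
    intro i j
    have h1 : DifferentiableAt ℝ (fun y => fderiv ℝ v y (EuclideanSpace.single j 1)) x :=
      hdv.clm_apply (differentiableAt_const _)
    refine (differentiableAt_euclidean.1 h1 i).congr_of_eventuallyEq ?_
    filter_upwards [hΩ.mem_nhds hx] with y hy
    rw [fderivWithin_of_isOpen_subset hΩ hD hy]
  have hqx : DifferentiableAt ℝ q x := (hq.contDiffAt (hΩ.mem_nhds hx)).differentiableAt one_ne_zero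
  simp only [stress_apply]
  exact (hqx.mul_const _).sub (((hg i j).add (hg j i)).const_mul _)

lemma hasFDerivAt_flux_apply (visc : ℝ) (hv : DifferentiableAt ℝ v x)
    (hS : ∀ i j, DifferentiableAt ℝ (fun y => stress visc D q v y i j) x) (i : Fin 2) :
    ∃ L : Plane →L[ℝ] ℝ, HasFDerivAt (fun y => flux visc D q v y i) L x ∧ ∀ e, L e
      = fderiv ℝ (fun y => stress visc D q v y i 0) x e * v x 0
        + stress visc D q v x i 0 * fderiv ℝ v x e 0
        + fderiv ℝ (fun y => stress visc D q v y i 1) x e * v x 1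
        + stress visc D q v x i 1 * fderiv ℝ v x e 1
        + (v x 0 * fderiv ℝ v x e 0 + v x 1 * fderiv ℝ v x e 1) * v x i
        + 1 / 2 * ‖v x‖ ^ 2 * fderiv ℝ v x e i := by
  have hc := fun k => hasFDerivAt_plane_apply hv.hasFDerivAt k
  have h := ((((hS i 0).hasFDerivAt.mul (hc 0)).add ((hS i 1).hasFDerivAt.mul (hc 1))).add
    (((((hc 0).mul (hc 0)).add ((hc 1).mul (hc 1))).const_mul (1 / 2)).mul (hc i)))
  refine ⟨_, h.congr_of_eventuallyEq (Eventually.of_forall fun y => ?_), fun e => ?_⟩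
  · simp only [flux, PiLp.add_apply, PiLp.smul_apply, act_apply, plane_norm_sq, smul_eq_mul,
      Pi.add_apply, Pi.mul_apply]
    ring
  · simp only [plane_norm_sq, add_apply, smul_apply,
      ContinuousLinearMap.comp_apply, PiLp.proj_apply, smul_eq_mul, Pi.add_apply,
      Pi.mul_apply]
    ring

lemma divVec_flux (visc : ℝ) (hΩ : IsOpen Ω) (hD : Ω ⊆ D) (hv : ContDiffOn ℝ 2 v Ω)
    (hq : ContDiffOn ℝ 1 q Ω) (hx : x ∈ Ω) (hdiv : divVec v x = 0) :
    DifferentiableAt ℝ (flux visc D q v) x ∧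
    divVec (flux visc D q v) x = inner ℝ (v x) (divMat (stress visc D q v) x)
      + inner ℝ (v x) (fderiv ℝ v x (v x)) - visc / 2 * symGradSq D v x := by
  have hvx : DifferentiableAt ℝ v x := (hv.contDiffAt (hΩ.mem_nhds hx)).differentiableAt two_ne_zero
  have hS := differentiableAt_stress visc hΩ hD hv hq hx
  have hF : DifferentiableAt ℝ (flux visc D q v) x := differentiableAt_plane fun i =>
    let ⟨_, h, _⟩ := hasFDerivAt_flux_apply visc hvx hS i
    h.differentiableAt
  refine ⟨hF, ?_⟩
  obtain ⟨L0, h0, e0⟩ := hasFDerivAt_flux_apply visc hvx hS 0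
  obtain ⟨L1, h1, e1⟩ := hasFDerivAt_flux_apply visc hvx hS 1
  have k0 := h0.unique (hasFDerivAt_plane_apply hF.hasFDerivAt 0)
  have k1 := h1.unique (hasFDerivAt_plane_apply hF.hasFDerivAt 1)
  have v0 : (fderiv ℝ (flux visc D q v) x (EuclideanSpace.single 0 1)) 0
      = L0 (EuclideanSpace.single 0 1) := by rw [k0]; rfl
  have v1 : (fderiv ℝ (flux visc D q v) x (EuclideanSpace.single 1 1)) 1
      = L1 (EuclideanSpace.single 1 1) := by rw [k1]; rfl
  have hsym : (fun y => stress visc D q v y 1 0) = fun y => stress visc D q v y 0 1 :=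
    funext fun y => stress_symm visc D q v y 1 0
  rw [divVec, Fin.sum_univ_two] at hdiv ⊢
  rw [v0, v1, e0, e1, plane_inner, plane_inner, clm_plane_apply (fderiv ℝ v x) (v x)]
  simp only [divMat, Fin.sum_univ_two, symGradSq, symGrad, grad, Matrix.add_apply,
    Matrix.transpose_apply, Matrix.of_apply, PiLp.add_apply, PiLp.smul_apply, smul_eq_mul,
    stress_apply, fderivWithin_of_isOpen_subset hΩ hD hx]
  simp only [stress_apply] at hsym
  simp only [hsym]
  simp only [if_true, zero_ne_one, one_ne_zero, if_false]
  linear_combination (q x + 1 / 2 * ‖v x‖ ^ 2) * hdiv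

end Div

/-! ### Traces on the edges of the parameter cell -/

/-- The closed parameter cell without the points that parametrize the corners. -/
def edgeCell (p : Params) : Set (ℝ × ℝ) :=
  {z | z ∈ Icc (0 : ℝ) 1 ×ˢ Icc p.lo p.hi ∧ 0 < z.1 ∧ (z.1 < 1 ∨ z.2 ∈ Ioo p.lo p.hi)}

lemma cell_subset_edgeCell (p : Params) : cell p ⊆ edgeCell p := fun _ hz =>
  ⟨⟨Ioo_subset_Icc_self hz.1, Ioo_subset_Icc_self hz.2⟩, hz.1.1, Or.inl hz.1.2⟩

lemma continuousOn_plane {α : Type*} [TopologicalSpace α] {f : α → Plane} {s : Set α}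
    (h : ∀ i, ContinuousOn (fun z => f z i) s) : ContinuousOn f s :=
  (PiLp.continuous_toLp 2 _).comp_continuousOn (continuousOn_pi.2 h)

lemma continuousOn_plane_apply {α : Type*} [TopologicalSpace α] {f : α → Plane} {s : Set α}
    (h : ContinuousOn f s) (i : Fin 2) : ContinuousOn (fun z => f z i) s :=
  (EuclideanSpace.proj i : Plane →L[ℝ] ℝ).continuous.comp_continuousOn h

lemma plane_apply_le_norm (x : Plane) (i : Fin 2) : |x i| ≤ ‖x‖ := PiLp.norm_apply_le x i

lemma plane_norm_le (x : Plane) : ‖x‖ ≤ |x 0| + |x 1| := by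
  refine le_of_sq_le_sq ?_ (by positivity)
  rw [plane_norm_sq, ← sq_abs (x 0), ← sq_abs (x 1)]
  nlinarith [abs_nonneg (x 0), abs_nonneg (x 1)]

lemma norm_act_le {M : Matrix (Fin 2) (Fin 2) ℝ} {c : ℝ} (h : ∀ i j, |M i j| ≤ c) (n : Plane) :
    ‖act M n‖ ≤ 4 * c * ‖n‖ := by
  have hi : ∀ i, |act M n i| ≤ 2 * c * ‖n‖ := by
    intro i
    have hc : 0 ≤ c := (abs_nonneg _).trans (h 0 0)
    rw [act_apply]
    refine (abs_add_le _ _).trans ?_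
    rw [abs_mul, abs_mul]
    have h0 := mul_le_mul (h i 0) (plane_apply_le_norm n 0) (abs_nonneg _) hc
    have h1 := mul_le_mul (h i 1) (plane_apply_le_norm n 1) (abs_nonneg _) hc
    linarith
  linarith [plane_norm_le (act M n), hi 0, hi 1]

lemma gradient_entry_le (L : Plane →L[ℝ] Plane) (i j : Fin 2) :
    |L (EuclideanSpace.single j 1) i| ≤ ‖L‖ := by
  refine (plane_apply_le_norm _ i).trans ?_
  simpa using L.le_opNorm (EuclideanSpace.single j 1)

lemma stress_entry_le {visc : ℝ} (hμ : 0 ≤ visc) (D : Set Plane) (q : Plane → ℝ)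
    (v : Plane → Plane) (x : Plane) (i j : Fin 2) :
    |stress visc D q v x i j| ≤ (1 + 2 * visc) * (‖fderivWithin ℝ v D x‖ + |q x|) := by
  rw [stress_apply]
  have h1 := gradient_entry_le (fderivWithin ℝ v D x) i j
  have h2 := gradient_entry_le (fderivWithin ℝ v D x) j i
  have h3 : |q x * (if i = j then 1 else 0)| ≤ |q x| := by split_ifs <;> simp
  set L := fderivWithin ℝ v D x
  calc _ ≤ |q x * (if i = j then 1 else 0)| + |visc * ((L (EuclideanSpace.single j 1)) i
          + (L (EuclideanSpace.single i 1)) j)| := abs_sub _ _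
    _ ≤ |q x| + visc * (‖L‖ + ‖L‖) := by
        rw [abs_mul visc, abs_of_nonneg hμ]
        gcongr
        exact (abs_add_le _ _).trans (add_le_add h1 h2)
    _ ≤ _ := by nlinarith [norm_nonneg L, abs_nonneg (q x), mul_nonneg hμ (abs_nonneg (q x))]

lemma symGradSq_le (D : Set Plane) (v : Plane → Plane) (x : Plane) :
    symGradSq D v x ≤ 16 * ‖fderivWithin ℝ v D x‖ ^ 2 := by
  have h : ∀ i j, symGrad D v x i j ^ 2 ≤ (2 * ‖fderivWithin ℝ v D x‖) ^ 2 := by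
    intro i j
    rw [← sq_abs]
    gcongr
    simp only [symGrad, grad, Matrix.add_apply, Matrix.transpose_apply, Matrix.of_apply]
    refine (abs_add_le _ _).trans ?_
    linarith [gradient_entry_le (fderivWithin ℝ v D x) i j,
      gradient_entry_le (fderivWithin ℝ v D x) j i]
  simp only [symGradSq, Fin.sum_univ_two]
  linarith [h 0 0, h 0 1, h 1 0, h 1 1]

lemma symGradSq_nonneg (D : Set Plane) (v : Plane → Plane) (x : Plane) : 0 ≤ symGradSq D v x :=
  Finset.sum_nonneg fun _ _ => Finset.sum_nonneg fun _ _ => sq_nonneg _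

section Traces

variable {p : Params} {J : Set ℝ} {ρ : ℝ → ℝ → ℝ} {u : ℝ → Plane → Plane} {P : ℝ → Plane → ℝ}

lemma Regularity.scaledPolar_mem_regularPart (h : Regularity p J ρ u P) (hJ : IsOpen J) {t : ℝ}
    (ht : t ∈ J) {z : ℝ × ℝ} (hz : z ∈ edgeCell p) :
    scaledPolar (ρ t) z ∈ regularPart p (ρ t) := by
  obtain ⟨s, θ⟩ := z
  obtain ⟨⟨hs, hθ⟩, h0, h1⟩ := hz
  simp only at hs hθ h0 h1
  refine ⟨scaledPolar_mem_closure p (h.ρ_diff t ht).continuousOn (h.ρ_pos t ht) ⟨hs, hθ⟩, ?_⟩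
  obtain ⟨δ, m, M, -, hb⟩ := h.exists_surfaceBounds hJ ht one_pos
  have htb : t ∈ Metric.closedBall t δ := Metric.mem_closedBall_self hb.δ_pos.le
  have hm := hb.m_pos
  have hM0 : 0 ≤ M := (abs_nonneg _).trans (hb.dTheta_le t htb θ hθ)
  have key : ∀ φ ∈ Icc p.lo p.hi, (s < 1 ∨ θ ≠ φ) → scaledPolar (ρ t) (s, θ) ≠ ρ t φ • eR φ := by
    intro φ hφ hne heq
    obtain ⟨k1, k2⟩ := contact_dist p (h.ρ_diff t ht) hm (hb.lower t htb) (hb.dTheta_le t htb)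
      hs hθ hφ
    rw [heq, sub_self, norm_zero] at k1 k2
    rcases hne with hne | hne
    · have : 0 < m / (1 + M * π / m) * (1 - s) :=
        mul_pos (by have := pi_pos; positivity) (sub_pos.2 hne)
      linarith
    · have : 0 < m / π * |θ - φ| :=
        mul_pos (div_pos hm pi_pos) (abs_pos.2 (sub_ne_zero.2 hne))
      linarith
  simp only [corners, mem_insert_iff, mem_singleton_iff, not_or]
  refine ⟨fun heq => ?_, key _ (left_mem_Icc.2 p.lo_lt_hi.le) (h1.imp id fun h => h.1.ne'),
    key _ (right_mem_Icc.2 p.lo_lt_hi.le) (h1.imp id fun h => h.2.ne)⟩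
  have hn : ‖scaledPolar (ρ t) (s, θ)‖ = s * ρ t θ := by
    rw [scaledPolar, norm_smul, norm_eR, mul_one, norm_eq_abs,
      abs_of_pos (mul_pos h0 (h.ρ_pos t ht θ hθ))]
  rw [heq, norm_zero] at hn
  exact (mul_pos h0 (h.ρ_pos t ht θ hθ)).ne hn

lemma Regularity.isOpen_fluidDomain (h : Regularity p J ρ u P) {t : ℝ} (ht : t ∈ J) :
    IsOpen (fluidDomain p (ρ t)) := Droplet.isOpen_fluidDomain p (h.ρ_diff t ht).continuousOn

lemma Regularity.fluidDomain_subset_regularPart (h : Regularity p J ρ u P) (hJ : IsOpen J) {t : ℝ}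
    (ht : t ∈ J) : fluidDomain p (ρ t) ⊆ regularPart p (ρ t) := by
  rw [fluidDomain_eq_image p (h.ρ_pos t ht)]
  rintro _ ⟨z, hz, rfl⟩
  exact h.scaledPolar_mem_regularPart hJ ht (cell_subset_edgeCell p hz)

lemma Regularity.scaledPolar_mem_fluidDomain (h : Regularity p J ρ u P) {t : ℝ} (ht : t ∈ J)
    {z : ℝ × ℝ} (hz : z ∈ cell p) : scaledPolar (ρ t) z ∈ fluidDomain p (ρ t) :=
  Droplet.scaledPolar_mem_fluidDomain (h.ρ_pos t ht) hz

lemma Regularity.fderivWithin_eq (h : Regularity p J ρ u P) (hJ : IsOpen J) {t : ℝ} (ht : t ∈ J)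
    {x : Plane} (hx : x ∈ fluidDomain p (ρ t)) :
    fderivWithin ℝ (u t) (regularPart p (ρ t)) x = fderiv ℝ (u t) x :=
  fderivWithin_of_isOpen_subset (h.isOpen_fluidDomain ht)
    (h.fluidDomain_subset_regularPart hJ ht) hx

lemma Regularity.continuousOn_scaledPolar (h : Regularity p J ρ u P) {t : ℝ} (ht : t ∈ J) :
    ContinuousOn (scaledPolar (ρ t)) (edgeCell p) :=
  (Droplet.continuousOn_scaledPolar p (h.ρ_diff t ht).continuousOn).mono fun _ hz => hz.1

lemma Regularity.continuousOn_velocity_spacetime (h : Regularity p J ρ u P) :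
    ContinuousOn (fun y : ℝ × ℝ × ℝ => u y.1 (scaledPolar (ρ y.1) y.2))
      (J ×ˢ Icc (0 : ℝ) 1 ×ˢ Icc p.lo p.hi) := by
  refine h.u_cont.comp (f := fun y : ℝ × ℝ × ℝ => (y.1, scaledPolar (ρ y.1) y.2)) ?_ ?_
  · refine continuous_fst.continuousOn.prodMk ?_
    unfold scaledPolar
    refine ContinuousOn.smul ((by fun_prop : Continuous fun y : ℝ × ℝ × ℝ => y.2.1).continuousOn.mul
      ?_) (continuous_eR.comp (by fun_prop : Continuous fun y : ℝ × ℝ × ℝ => y.2.2)).continuousOn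
    exact h.ρ_cont.comp (f := fun y : ℝ × ℝ × ℝ => (y.1, y.2.2))
      (by fun_prop : Continuous fun y : ℝ × ℝ × ℝ => (y.1, y.2.2)).continuousOn
      fun y hy => ⟨hy.1, hy.2.2⟩
  · intro y hy
    exact ⟨hy.1, scaledPolar_mem_closure p (h.ρ_diff _ hy.1).continuousOn (h.ρ_pos _ hy.1) hy.2⟩

lemma Regularity.continuousOn_velocity (h : Regularity p J ρ u P) {t : ℝ} (ht : t ∈ J) :
    ContinuousOn (fun z => u t (scaledPolar (ρ t) z)) (Icc (0 : ℝ) 1 ×ˢ Icc p.lo p.hi) :=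
  h.continuousOn_velocity_spacetime.comp (Continuous.prodMk_right t).continuousOn
    fun _ hz => ⟨ht, hz⟩

lemma Regularity.exists_velocity_bound (h : Regularity p J ρ u P) {t₀ δ : ℝ}
    (hb : Metric.closedBall t₀ δ ⊆ J) :
    ∃ U, 0 ≤ U ∧ ∀ t ∈ Metric.closedBall t₀ δ, ∀ z ∈ Icc (0 : ℝ) 1 ×ˢ Icc p.lo p.hi,
      ‖u t (scaledPolar (ρ t) z)‖ ≤ U := by
  have hK : IsCompact (Metric.closedBall t₀ δ ×ˢ (Icc (0 : ℝ) 1 ×ˢ Icc p.lo p.hi)) :=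
    (isCompact_closedBall _ _).prod (isCompact_Icc.prod isCompact_Icc)
  obtain ⟨U, hU⟩ := hK.exists_bound_of_continuousOn
    (h.continuousOn_velocity_spacetime.mono (Set.prod_mono hb subset_rfl))
  exact ⟨max U 0, le_max_right _ _, fun t ht z hz => (hU (t, z) ⟨ht, hz⟩).trans (le_max_left _ _)⟩

lemma Regularity.continuousOn_gradient_entry (h : Regularity p J ρ u P) (hJ : IsOpen J) {t : ℝ}
    (ht : t ∈ J) (i j : Fin 2) : ContinuousOn (fun z => (fderivWithin ℝ (u t) (regularPart p (ρ t))
      (scaledPolar (ρ t) z) (EuclideanSpace.single j 1)) i) (edgeCell p) :=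
  continuousOn_plane_apply (((h.du_cont t ht).comp (h.continuousOn_scaledPolar ht)
    fun _ hz => h.scaledPolar_mem_regularPart hJ ht hz).clm_apply continuousOn_const) i

lemma Regularity.continuousOn_stress (h : Regularity p J ρ u P) (hJ : IsOpen J) {t : ℝ}
    (ht : t ∈ J) (i j : Fin 2) : ContinuousOn (fun z => stress p.visc (regularPart p (ρ t)) (P t)
      (u t) (scaledPolar (ρ t) z) i j) (edgeCell p) := by
  simp only [stress_apply]
  exact (((h.P_cont t ht).comp (h.continuousOn_scaledPolar ht)
    fun _ hz => h.scaledPolar_mem_regularPart hJ ht hz).mul continuousOn_const).sub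
    (continuousOn_const.mul ((h.continuousOn_gradient_entry hJ ht i j).add
      (h.continuousOn_gradient_entry hJ ht j i)))

lemma Regularity.continuousOn_act_stress (h : Regularity p J ρ u P) (hJ : IsOpen J) {t : ℝ}
    (ht : t ∈ J) {n : ℝ × ℝ → Plane} {E : Set (ℝ × ℝ)} (hE : E ⊆ edgeCell p)
    (hn : ContinuousOn n E) : ContinuousOn (fun z => act (stress p.visc
      (regularPart p (ρ t)) (P t) (u t) (scaledPolar (ρ t) z)) (n z)) E := by
  refine continuousOn_plane fun i => ?_
  simp only [act_apply]
  exact (((h.continuousOn_stress hJ ht i 0).mono hE).mul (continuousOn_plane_apply hn 0)).add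
    (((h.continuousOn_stress hJ ht i 1).mono hE).mul (continuousOn_plane_apply hn 1))

lemma Regularity.continuousOn_flux (h : Regularity p J ρ u P) (hJ : IsOpen J) {t : ℝ}
    (ht : t ∈ J) : ContinuousOn (fun z => flux p.visc (regularPart p (ρ t)) (P t) (u t)
      (scaledPolar (ρ t) z)) (edgeCell p) := by
  have hu : ContinuousOn (fun z => u t (scaledPolar (ρ t) z)) (edgeCell p) :=
    (h.continuousOn_velocity ht).mono fun _ hz => hz.1
  exact (h.continuousOn_act_stress hJ ht subset_rfl hu).add
    ((continuousOn_const.mul (hu.norm.pow 2)).smul hu)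

lemma Regularity.continuousOn_symGradSq (h : Regularity p J ρ u P) (hJ : IsOpen J) {t : ℝ}
    (ht : t ∈ J) : ContinuousOn (fun z => symGradSq (regularPart p (ρ t)) (u t)
      (scaledPolar (ρ t) z)) (edgeCell p) := by
  simp only [symGradSq, symGrad, grad, Matrix.add_apply, Matrix.transpose_apply, Matrix.of_apply]
  exact continuousOn_finsetSum _ fun i _ => continuousOn_finsetSum _ fun j _ =>
    ((h.continuousOn_gradient_entry hJ ht i j).add (h.continuousOn_gradient_entry hJ ht j i)).pow 2

lemma Regularity.continuousOn_normalN (h : Regularity p J ρ u P) {t : ℝ} (ht : t ∈ J) :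
    ContinuousOn (normalN p (ρ t)) (Icc p.lo p.hi) :=
  ((h.ρ_diff t ht).continuousOn.smul continuous_eR.continuousOn).sub
    ((h.continuousOn_dTheta ht).smul continuous_ePhi.continuousOn)

/-! ### Bounds in the parameter cell -/

lemma Regularity.norm_act_stress_le (h : Regularity p J ρ u P) (hJ : IsOpen J) {t : ℝ}
    (ht : t ∈ J) {z : ℝ × ℝ} (hz : z ∈ cell p) (n : Plane) :
    ‖act (stress p.visc (regularPart p (ρ t)) (P t) (u t) (scaledPolar (ρ t) z)) n‖
      ≤ 4 * ((1 + 2 * p.visc) * growthQuantity u P t (scaledPolar (ρ t) z)) * ‖n‖ := by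
  refine norm_act_le (fun i j => (stress_entry_le p.visc_pos.le _ _ _ _ i j).trans ?_) n
  rw [h.fderivWithin_eq hJ ht (h.scaledPolar_mem_fluidDomain ht hz)]
  have := p.visc_pos
  unfold growthQuantity
  gcongr
  linarith [norm_nonneg (deriv (fun s => u s (scaledPolar (ρ t) z)) t)]

lemma growthQuantity_nonneg (u : ℝ → Plane → Plane) (P : ℝ → Plane → ℝ) (t : ℝ) (x : Plane) :
    0 ≤ growthQuantity u P t x := by
  unfold growthQuantity; positivity

lemma Regularity.norm_flux_le (h : Regularity p J ρ u P) (hJ : IsOpen J) {t U : ℝ}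
    (ht : t ∈ J) {z : ℝ × ℝ} (hz : z ∈ cell p) (hU : ‖u t (scaledPolar (ρ t) z)‖ ≤ U) :
    ‖flux p.visc (regularPart p (ρ t)) (P t) (u t) (scaledPolar (ρ t) z)‖
      ≤ 4 * (1 + 2 * p.visc) * U * growthQuantity u P t (scaledPolar (ρ t) z) + U ^ 3 := by
  have hU0 : 0 ≤ U := (norm_nonneg _).trans hU
  have hμ := p.visc_pos
  have hG := growthQuantity_nonneg u P t (scaledPolar (ρ t) z)
  have h1 := h.norm_act_stress_le hJ ht hz (u t (scaledPolar (ρ t) z))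
  unfold flux
  refine (norm_add_le _ _).trans (add_le_add (h1.trans ?_) ?_)
  · calc _ ≤ 4 * ((1 + 2 * p.visc) * growthQuantity u P t (scaledPolar (ρ t) z)) * U := by gcongr
      _ = _ := by ring
  · rw [norm_smul, norm_eq_abs, abs_of_nonneg (by positivity)]
    calc _ ≤ (1 / 2 * U ^ 2) * U := by gcongr
      _ ≤ U ^ 3 := by nlinarith [pow_nonneg hU0 3]

lemma CellGrowth.mul_le {G : ℝ → Plane → ℝ} {t₀ δ C e : ℝ} (hg : CellGrowth p J ρ G t₀ δ C e)
    {t : ℝ} (ht : t ∈ Metric.closedBall t₀ δ) {z : ℝ × ℝ} (hz : z ∈ cell p) :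
    z.1 * G t (scaledPolar (ρ t) z) ≤ C * (1 + angleWeight p e z.2) := by
  have h0 : 0 < z.1 := hz.1.1
  have h1 : z.1 ≤ 1 := hz.1.2.le
  have hw := angleWeight_nonneg p e (Ioo_subset_Icc_self hz.2)
  have hs : z.1 * z.1 ^ e ≤ 1 := by
    have : z.1 * z.1 ^ e = z.1 ^ (1 + e) := by rw [rpow_add h0, rpow_one]
    rw [this]
    exact rpow_le_one h0.le h1 (by linarith [hg.lt_e])
  calc _ ≤ z.1 * (C * (z.1 ^ e + angleWeight p e z.2)) := by
        gcongr; exact hg.angle t ht z hz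
    _ = C * (z.1 * z.1 ^ e + z.1 * angleWeight p e z.2) := by ring
    _ ≤ C * (1 + angleWeight p e z.2) := by
        have := hg.C_nonneg
        gcongr
        exact mul_le_of_le_one_left hw h1

lemma Regularity.integrableOn_symGradSq (h : Regularity p J ρ u P) (hJ : IsOpen J) {t : ℝ}
    (ht : t ∈ J) :
    IntegrableOn (fun z => z.1 * ρ t z.2 ^ 2 * symGradSq (regularPart p (ρ t)) (u t)
      (scaledPolar (ρ t) z)) (cell p) := by
  obtain ⟨δ, m, M, C, e, hb, hg⟩ := h.exists_cellGrowth hJ ht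
  have htb : t ∈ Metric.closedBall t δ := Metric.mem_closedBall_self hb.δ_pos.le
  have hdom : IntegrableOn (fun z : ℝ × ℝ => (16 * M ^ 2 * C ^ 2) *
      ((z.1 ^ e + (1 - z.1) ^ e) * (1 + angleWeight p e z.2))) (cell p) := by
    have h1 := (integrableOn_rpow_Ioo hg.lt_e).add (integrableOn_one_sub_rpow_Ioo hg.lt_e)
    have h2 : IntegrableOn (fun θ => 1 + angleWeight p e θ) (Ioo p.lo p.hi) :=
      (integrableOn_const (by simp)).add (integrableOn_angleWeight p hg.lt_e)
    have h3 := (Integrable.mul_prod h1 h2).const_mul (16 * M ^ 2 * C ^ 2)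
    rw [Measure.prod_restrict] at h3
    exact h3
  have hcont : ContinuousOn (fun z => z.1 * ρ t z.2 ^ 2 * symGradSq (regularPart p (ρ t)) (u t)
      (scaledPolar (ρ t) z)) (cell p) := by
    refine (continuous_fst.continuousOn.mul (ContinuousOn.pow ?_ 2)).mul
      ((h.continuousOn_symGradSq hJ ht).mono (cell_subset_edgeCell p))
    exact (h.ρ_diff t ht).continuousOn.comp continuous_snd.continuousOn
      fun z hz => Ioo_subset_Icc_self hz.2
  refine Integrable.mono' hdom (hcont.aestronglyMeasurable (isOpen_cell p).measurableSet) ?_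
  refine (ae_restrict_iff' (isOpen_cell p).measurableSet).2 (ae_of_all _ fun z hz => ?_)
  have hzθ := Ioo_subset_Icc_self hz.2
  have h0 : 0 < z.1 := hz.1.1
  set G := growthQuantity u P t (scaledPolar (ρ t) z) with hG
  have hG0 : 0 ≤ G := growthQuantity_nonneg _ _ _ _
  have hs : symGradSq (regularPart p (ρ t)) (u t) (scaledPolar (ρ t) z) ≤ 16 * G ^ 2 := by
    refine (symGradSq_le _ _ _).trans ?_
    rw [h.fderivWithin_eq hJ ht (h.scaledPolar_mem_fluidDomain ht hz)]
    gcongr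
    rw [hG, growthQuantity]
    linarith [norm_nonneg (deriv (fun s => u s (scaledPolar (ρ t) z)) t),
      abs_nonneg (P t (scaledPolar (ρ t) z))]
  have hρ0 := h.ρ_pos t ht _ hzθ
  have hρM := hb.upper t htb _ hzθ
  have hnn := symGradSq_nonneg (regularPart p (ρ t)) (u t) (scaledPolar (ρ t) z)
  have hC := hg.C_nonneg
  have hw := angleWeight_nonneg p e hzθ
  rw [norm_eq_abs, abs_of_nonneg (by positivity)]
  calc _ ≤ z.1 * M ^ 2 * (16 * G ^ 2) := by gcongr
    _ = 16 * M ^ 2 * ((z.1 * G) * G) := by ring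
    _ ≤ 16 * M ^ 2 * ((C * (1 + angleWeight p e z.2)) * (C * (z.1 ^ e + (1 - z.1) ^ e))) := by
        refine mul_le_mul_of_nonneg_left ?_ (by positivity)
        exact mul_le_mul (hg.mul_le htb hz) (hg.radial t htb z hz) hG0 (by positivity)
    _ = _ := by ring

end Traces

section Kinetic

variable {p : Params} {J : Set ℝ} {ρ : ℝ → ℝ → ℝ} {u : ℝ → Plane → Plane} {P : ℝ → Plane → ℝ}

/-! ### The kinetic energy in the parameter cell -/

/-- The kinetic energy density in the parameter cell, including the Jacobian. -/
def kinetic (ρ : ℝ → ℝ → ℝ) (u : ℝ → Plane → Plane) (t : ℝ) (z : ℝ × ℝ) : ℝ :=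
  z.1 * ρ t z.2 ^ 2 * (1 / 2 * ‖u t (scaledPolar (ρ t) z)‖ ^ 2)

/-- The time derivative of `kinetic`. -/
def kineticDeriv (ρ : ℝ → ℝ → ℝ) (u : ℝ → Plane → Plane) (t : ℝ) (z : ℝ × ℝ) : ℝ :=
  z.1 * ρ t z.2 * deriv (fun s => ρ s z.2) t * ‖u t (scaledPolar (ρ t) z)‖ ^ 2
    + z.1 * ρ t z.2 ^ 2 * inner ℝ (u t (scaledPolar (ρ t) z))
      (deriv (fun s => u s (scaledPolar (ρ t) z)) t
        + fderiv ℝ (u t) (scaledPolar (ρ t) z) ((z.1 * deriv (fun s => ρ s z.2) t) • eR z.2))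

lemma Regularity.isOpen_spacetime (h : Regularity p J ρ u P) (hJ : IsOpen J) :
    IsOpen {z : ℝ × Plane | z.1 ∈ J ∧ z.2 ∈ fluidDomain p (ρ z.1)} :=
  Droplet.isOpen_spacetime p hJ h.ρ_cont

lemma Regularity.hasFDerivAt_spacetime (h : Regularity p J ρ u P) (hJ : IsOpen J) {t : ℝ}
    (ht : t ∈ J) {x : Plane} (hx : x ∈ fluidDomain p (ρ t)) :
    HasFDerivAt (fun z : ℝ × Plane => u z.1 z.2)
      (fderiv ℝ (fun z : ℝ × Plane => u z.1 z.2) (t, x)) (t, x) :=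
  ((h.u_contDiff_one.contDiffAt ((h.isOpen_spacetime hJ).mem_nhds ⟨ht, hx⟩)).differentiableAt
    one_ne_zero).hasFDerivAt

lemma Regularity.deriv_velocity_eq (h : Regularity p J ρ u P) (hJ : IsOpen J) {t : ℝ}
    (ht : t ∈ J) {x : Plane} (hx : x ∈ fluidDomain p (ρ t)) :
    deriv (fun s => u s x) t = fderiv ℝ (fun z : ℝ × Plane => u z.1 z.2) (t, x) (1, 0) := by
  have h1 : HasDerivAt (fun s : ℝ => (s, x)) ((1 : ℝ), (0 : Plane)) t :=
    (hasDerivAt_id t).prodMk (hasDerivAt_const t x)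
  exact ((h.hasFDerivAt_spacetime hJ ht hx).comp_hasDerivAt t h1).deriv

lemma Regularity.fderiv_velocity_eq (h : Regularity p J ρ u P) (hJ : IsOpen J) {t : ℝ}
    (ht : t ∈ J) {x : Plane} (hx : x ∈ fluidDomain p (ρ t)) (v : Plane) :
    fderiv ℝ (u t) x v = fderiv ℝ (fun z : ℝ × Plane => u z.1 z.2) (t, x) (0, v) := by
  have h1 : HasFDerivAt (u t) _ x := (h.hasFDerivAt_spacetime hJ ht hx).comp x
    ((hasFDerivAt_const t x).prodMk (hasFDerivAt_id x))
  rw [h1.fderiv]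
  rfl

lemma Regularity.hasDerivAt_velocity (h : Regularity p J ρ u P) (hJ : IsOpen J) {t : ℝ}
    (ht : t ∈ J) {z : ℝ × ℝ} (hz : z ∈ cell p) :
    HasDerivAt (fun τ => u τ (scaledPolar (ρ τ) z))
      (deriv (fun s => u s (scaledPolar (ρ t) z)) t
        + fderiv ℝ (u t) (scaledPolar (ρ t) z) ((z.1 * deriv (fun s => ρ s z.2) t) • eR z.2)) t := by
  have hx := h.scaledPolar_mem_fluidDomain ht hz
  have hγ : HasDerivAt (fun τ => (τ, scaledPolar (ρ τ) z))
      ((1 : ℝ), (z.1 * deriv (fun s => ρ s z.2) t) • eR z.2) t :=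
    (hasDerivAt_id t).prodMk (((h.ρ_time_diff t ht z.2
      (Ioo_subset_Icc_self hz.2)).hasDerivAt.const_mul z.1).smul_const (eR z.2))
  have h1 := (h.hasFDerivAt_spacetime hJ ht hx).comp_hasDerivAt t hγ
  refine h1.congr_deriv ?_
  rw [h.deriv_velocity_eq hJ ht hx, h.fderiv_velocity_eq hJ ht hx, ← map_add]
  simp

lemma Regularity.hasDerivAt_kinetic (h : Regularity p J ρ u P) (hJ : IsOpen J) {t : ℝ}
    (ht : t ∈ J) {z : ℝ × ℝ} (hz : z ∈ cell p) :
    HasDerivAt (fun τ => kinetic ρ u τ z) (kineticDeriv ρ u t z) t := by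
  have h1 := ((((h.ρ_time_diff t ht z.2 (Ioo_subset_Icc_self hz.2)).hasDerivAt.pow 2).const_mul
    z.1).mul (((h.hasDerivAt_velocity hJ ht hz).norm_sq).const_mul (1 / 2)))
  refine h1.congr_deriv ?_
  simp only [kineticDeriv, Pi.pow_apply]
  push_cast
  ring

lemma Regularity.continuousOn_surface_cell (h : Regularity p J ρ u P) {t : ℝ} (ht : t ∈ J) :
    ContinuousOn (fun z : ℝ × ℝ => ρ t z.2) (Icc (0 : ℝ) 1 ×ˢ Icc p.lo p.hi) :=
  (h.ρ_diff t ht).continuousOn.comp continuous_snd.continuousOn fun _ hz => hz.2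

lemma Regularity.continuousOn_time_deriv_cell (h : Regularity p J ρ u P) {t : ℝ} (ht : t ∈ J) :
    ContinuousOn (fun z : ℝ × ℝ => deriv (fun s => ρ s z.2) t)
      (Icc (0 : ℝ) 1 ×ˢ Icc p.lo p.hi) :=
  (h.continuousOn_time_deriv ht).comp continuous_snd.continuousOn fun _ hz => hz.2

lemma cell_subset_Icc (p : Params) : cell p ⊆ Icc (0 : ℝ) 1 ×ˢ Icc p.lo p.hi :=
  Set.prod_mono Ioo_subset_Icc_self Ioo_subset_Icc_self

lemma Regularity.continuousOn_kinetic (h : Regularity p J ρ u P) {t : ℝ} (ht : t ∈ J) :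
    ContinuousOn (kinetic ρ u t) (Icc (0 : ℝ) 1 ×ˢ Icc p.lo p.hi) :=
  (continuous_fst.continuousOn.mul ((h.continuousOn_surface_cell ht).pow 2)).mul
    (continuousOn_const.mul ((h.continuousOn_velocity ht).norm.pow 2))

lemma Regularity.integrableOn_kinetic (h : Regularity p J ρ u P) {t : ℝ} (ht : t ∈ J) :
    IntegrableOn (kinetic ρ u t) (cell p) :=
  ((h.continuousOn_kinetic ht).integrableOn_compact (isCompact_Icc.prod isCompact_Icc)).mono_set
    (cell_subset_Icc p)

lemma Regularity.continuousOn_kineticDeriv (h : Regularity p J ρ u P) (hJ : IsOpen J) {t : ℝ}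
    (ht : t ∈ J) : ContinuousOn (kineticDeriv ρ u t) (cell p) := by
  have cs := cell_subset_Icc p
  have cρ := (h.continuousOn_surface_cell ht).mono cs
  have crt := (h.continuousOn_time_deriv_cell ht).mono cs
  have cu := (h.continuousOn_velocity ht).mono cs
  have cfst : ContinuousOn (Prod.fst : ℝ × ℝ → ℝ) (cell p) := continuous_fst.continuousOn
  have cV : ContinuousOn (fun z => fderiv ℝ (fun y : ℝ × Plane => u y.1 y.2)
      (t, scaledPolar (ρ t) z)) (cell p) := by
    refine (h.u_contDiff_one.continuousOn_fderiv_of_isOpen (h.isOpen_spacetime hJ) le_rfl).comp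
      (f := fun z => (t, scaledPolar (ρ t) z)) ?_ ?_
    · exact continuousOn_const.prodMk
        ((h.continuousOn_scaledPolar ht).mono (cell_subset_edgeCell p))
    · exact fun z hz => ⟨ht, h.scaledPolar_mem_fluidDomain ht hz⟩
  have cdir : ContinuousOn (fun z : ℝ × ℝ =>
      ((1 : ℝ), (z.1 * deriv (fun s => ρ s z.2) t) • eR z.2)) (cell p) :=
    continuousOn_const.prodMk
      ((cfst.mul crt).smul (continuous_eR.comp continuous_snd).continuousOn)
  have hmain : ContinuousOn (fun z : ℝ × ℝ =>
      z.1 * ρ t z.2 * deriv (fun s => ρ s z.2) t * ‖u t (scaledPolar (ρ t) z)‖ ^ 2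
      + z.1 * ρ t z.2 ^ 2 * inner ℝ (u t (scaledPolar (ρ t) z))
        (fderiv ℝ (fun y : ℝ × Plane => u y.1 y.2) (t, scaledPolar (ρ t) z)
          ((1 : ℝ), (z.1 * deriv (fun s => ρ s z.2) t) • eR z.2))) (cell p) :=
    (((cfst.mul cρ).mul crt).mul (cu.norm.pow 2)).add
      ((cfst.mul (cρ.pow 2)).mul (cu.inner (cV.clm_apply cdir)))
  refine hmain.congr fun z hz => ?_
  have hx := h.scaledPolar_mem_fluidDomain ht hz
  rw [kineticDeriv, h.deriv_velocity_eq hJ ht hx, h.fderiv_velocity_eq hJ ht hx, ← map_add]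
  simp

/-- The kinetic energy is differentiable in time under the integral sign. -/
theorem Regularity.hasDerivAt_integral_kinetic (h : Regularity p J ρ u P) (hJ : IsOpen J) {t : ℝ}
    (ht : t ∈ J) : IntegrableOn (kineticDeriv ρ u t) (cell p) ∧
      HasDerivAt (fun τ => ∫ z in cell p, kinetic ρ u τ z)
        (∫ z in cell p, kineticDeriv ρ u t z) t := by
  obtain ⟨δ, m, M, C, e, hb, hg⟩ := h.exists_cellGrowth hJ ht
  obtain ⟨U, hU0, hU⟩ := h.exists_velocity_bound hb.ball
  have hm := (isOpen_cell p).measurableSet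
  let bound : ℝ × ℝ → ℝ := fun z =>
    M * M * U ^ 2 + M ^ 2 * (U * ((1 + M) * (C * (1 + angleWeight p e z.2))))
  have hbound : IntegrableOn bound (cell p) := by
    have hw : IntegrableOn (fun θ => M * M * U ^ 2
        + M ^ 2 * (U * ((1 + M) * (C * (1 + angleWeight p e θ))))) (Ioo p.lo p.hi) :=
      (integrableOn_const (by simp)).add ((((((integrableOn_const (by simp)).add
        (integrableOn_angleWeight p hg.lt_e)).const_mul C).const_mul (1 + M)).const_mul U).const_mul
        (M ^ 2))
    have h1 : IntegrableOn (fun _ : ℝ => (1 : ℝ)) (Ioo 0 1) := integrableOn_const (by simp)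
    have h2 := Integrable.mul_prod h1 hw
    rw [Measure.prod_restrict] at h2
    simp only [one_mul] at h2
    exact h2
  refine hasDerivAt_integral_of_dominated_loc_of_deriv_le (bound := bound)
    (Metric.closedBall_mem_nhds t hb.δ_pos) ?_ (h.integrableOn_kinetic ht) ?_ ?_ hbound ?_
  · filter_upwards [hJ.mem_nhds ht] with τ hτ
    exact (h.integrableOn_kinetic hτ).aestronglyMeasurable
  · exact (h.continuousOn_kineticDeriv hJ ht).aestronglyMeasurable hm
  · refine (ae_restrict_iff' hm).2 (ae_of_all _ fun z hz τ hτ => ?_)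
    have hzθ := Ioo_subset_Icc_self hz.2
    have h0 : 0 < z.1 := hz.1.1
    have h1 : z.1 ≤ 1 := hz.1.2.le
    have hρ0 := h.ρ_pos τ (hb.ball hτ) _ hzθ
    have hρM := hb.upper τ hτ _ hzθ
    have hrt := hb.deriv_le τ hτ _ hzθ
    have hM0 : 0 ≤ M := hρ0.le.trans hρM
    have hu := hU τ hτ z (cell_subset_Icc p hz)
    have hsG := hg.mul_le hτ hz
    set x := scaledPolar (ρ τ) z
    set G := growthQuantity u P τ x with hG
    set rt := deriv (fun s => ρ s z.2) τ
    have hGdef : ‖fderiv ℝ (u τ) x‖ ≤ G ∧ ‖deriv (fun s => u s x) τ‖ ≤ G := by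
      rw [hG, growthQuantity]
      constructor <;> linarith [norm_nonneg (deriv (fun s => u s x) τ), abs_nonneg (P τ x),
        norm_nonneg (fderiv ℝ (u τ) x)]
    have hG0 : 0 ≤ G := growthQuantity_nonneg _ _ _ _
    have hw : ‖deriv (fun s => u s x) τ + fderiv ℝ (u τ) x ((z.1 * rt) • eR z.2)‖
        ≤ (1 + M) * G := by
      have h2 : ‖(z.1 * rt) • eR z.2‖ ≤ M := by
        rw [norm_smul, norm_eR, mul_one, norm_eq_abs, abs_mul, abs_of_pos h0]
        nlinarith [abs_nonneg rt]
      have h3 : ‖fderiv ℝ (u τ) x ((z.1 * rt) • eR z.2)‖ ≤ G * M :=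
        (ContinuousLinearMap.le_opNorm _ _).trans
          (mul_le_mul hGdef.1 h2 (norm_nonneg _) hG0)
      linarith [norm_add_le (deriv (fun s => u s x) τ)
        (fderiv ℝ (u τ) x ((z.1 * rt) • eR z.2)), hGdef.2]
    rw [kineticDeriv, norm_eq_abs]
    refine (abs_add_le _ _).trans (add_le_add ?_ ?_)
    · rw [abs_mul, abs_mul, abs_mul, abs_of_pos h0, abs_of_pos hρ0,
        abs_of_nonneg (sq_nonneg ‖u τ x‖)]
      calc _ ≤ 1 * M * M * U ^ 2 := by gcongr
        _ = _ := by ring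
    · rw [abs_mul, abs_of_nonneg (by positivity)]
      have hi := (abs_real_inner_le_norm (u τ x)
        (deriv (fun s => u s x) τ + fderiv ℝ (u τ) x ((z.1 * rt) • eR z.2))).trans
        (mul_le_mul hu hw (norm_nonneg _) hU0)
      calc _ ≤ z.1 * M ^ 2 * (U * ((1 + M) * G)) := by gcongr
        _ = M ^ 2 * (U * ((1 + M) * (z.1 * G))) := by ring
        _ ≤ M ^ 2 * (U * ((1 + M) * (C * (1 + angleWeight p e z.2)))) := by
          have : 0 ≤ 1 + M := by linarith
          gcongr
  · exact (ae_restrict_iff' hm).2 (ae_of_all _ fun z hz τ hτ =>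
      h.hasDerivAt_kinetic hJ (hb.ball hτ) hz)

/-! ### The energy flux in the parameter cell -/

/-- The radial component of the pulled-back energy flux, relative to the moving surface. -/
def radialFlux (p : Params) (ρ : ℝ → ℝ → ℝ) (u : ℝ → Plane → Plane) (P : ℝ → Plane → ℝ) (t : ℝ)
    (z : ℝ × ℝ) : ℝ :=
  z.1 * inner ℝ (flux p.visc (regularPart p (ρ t)) (P t) (u t) (scaledPolar (ρ t) z))
    (normalN p (ρ t) z.2)
  - z.1 ^ 2 * (ρ t z.2 * deriv (fun s => ρ s z.2) t)
    * (1 / 2 * ‖u t (scaledPolar (ρ t) z)‖ ^ 2)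

/-- The angular component of the pulled-back energy flux. -/
def angularFlux (p : Params) (ρ : ℝ → ℝ → ℝ) (u : ℝ → Plane → Plane) (P : ℝ → Plane → ℝ) (t : ℝ)
    (z : ℝ × ℝ) : ℝ :=
  ρ t z.2 * inner ℝ (flux p.visc (regularPart p (ρ t)) (P t) (u t) (scaledPolar (ρ t) z))
    (ePhi z.2)

lemma Regularity.differentiableAt_velocity (h : Regularity p J ρ u P) {t : ℝ} (ht : t ∈ J)
    {x : Plane} (hx : x ∈ fluidDomain p (ρ t)) : DifferentiableAt ℝ (u t) x :=
  ((h.u_contDiff_two t ht).contDiffAt ((h.isOpen_fluidDomain ht).mem_nhds hx)).differentiableAt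
    two_ne_zero

lemma IsSolution.divVec_flux (hsol : IsSolution p J ρ u P) (hJ : IsOpen J) {t : ℝ} (ht : t ∈ J)
    {x : Plane} (hx : x ∈ fluidDomain p (ρ t)) :
    DifferentiableAt ℝ (flux p.visc (regularPart p (ρ t)) (P t) (u t)) x ∧
    divVec (flux p.visc (regularPart p (ρ t)) (P t) (u t)) x
      = -inner ℝ (u t x) (deriv (fun s => u s x) t)
        - p.visc / 2 * symGradSq (regularPart p (ρ t)) (u t) x := by
  have h := hsol.regularity
  obtain ⟨h1, h2⟩ := Droplet.divVec_flux p.visc (h.isOpen_fluidDomain ht)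
    (h.fluidDomain_subset_regularPart hJ ht) (h.u_contDiff_two t ht) (h.P_contDiff t ht) hx
    (hsol.incompressible t ht x hx)
  refine ⟨h1, ?_⟩
  have h3 := congrArg (fun w => inner ℝ (u t x) w) (hsol.momentum t ht x hx)
  simp only [inner_add_right, inner_zero_right] at h3
  rw [h2]
  linarith

lemma Regularity.differentiableAt_surface_snd (h : Regularity p J ρ u P) {t : ℝ} (ht : t ∈ J)
    {z : ℝ × ℝ} (hz : z ∈ cell p) : DifferentiableAt ℝ (fun z : ℝ × ℝ => ρ t z.2) z :=
  DifferentiableAt.comp (g := ρ t) z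
    (hasDerivAt_of_differentiableOn p (h.ρ_diff t ht) hz.2).differentiableAt differentiableAt_snd

lemma IsSolution.differentiableAt_angularFlux (hsol : IsSolution p J ρ u P) (hJ : IsOpen J) {t : ℝ}
    (ht : t ∈ J) {z : ℝ × ℝ} (hz : z ∈ cell p) :
    DifferentiableAt ℝ (angularFlux p ρ u P t) z := by
  have h := hsol.regularity
  have hF := (hsol.divVec_flux hJ ht (h.scaledPolar_mem_fluidDomain ht hz)).1
  have hΦ := differentiableAt_scaledPolar
    (hasDerivAt_of_differentiableOn p (h.ρ_diff t ht) hz.2).differentiableAt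
  exact (h.differentiableAt_surface_snd ht hz).mul ((hF.comp z hΦ).inner ℝ
    (DifferentiableAt.comp (g := ePhi) z (hasDerivAt_ePhi z.2).differentiableAt
      differentiableAt_snd))

lemma IsSolution.differentiableAt_radialFlux (hsol : IsSolution p J ρ u P) (hJ : IsOpen J) {t : ℝ}
    (ht : t ∈ J) {z : ℝ × ℝ} (hz : z ∈ cell p) :
    DifferentiableAt ℝ (radialFlux p ρ u P t) z := by
  have h := hsol.regularity
  have hx := h.scaledPolar_mem_fluidDomain ht hz
  have hF := (hsol.divVec_flux hJ ht hx).1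
  have hρ := (hasDerivAt_of_differentiableOn p (h.ρ_diff t ht) hz.2).differentiableAt
  have hΦ := differentiableAt_scaledPolar hρ
  have hu := (h.differentiableAt_velocity ht hx).comp z hΦ
  have hN : DifferentiableAt ℝ (normalN p (ρ t)) z.2 :=
    (hρ.smul (hasDerivAt_eR z.2).differentiableAt).sub
      ((h.differentiableAt_slope ht hz.2).smul (hasDerivAt_ePhi z.2).differentiableAt)
  have hN' : DifferentiableAt ℝ (fun z : ℝ × ℝ => normalN p (ρ t) z.2) z :=
    DifferentiableAt.comp (g := normalN p (ρ t)) z hN differentiableAt_snd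
  have hrt : DifferentiableAt ℝ (fun z : ℝ × ℝ => deriv (fun s => ρ s z.2) t) z :=
    DifferentiableAt.comp (g := fun θ => deriv (fun s => ρ s θ) t) z
      (h.hasDerivAt_time_deriv hJ ht hz.2).differentiableAt differentiableAt_snd
  exact (differentiableAt_fst.mul ((hF.comp z hΦ).inner ℝ hN')).sub
    (((differentiableAt_fst.pow 2).mul ((h.differentiableAt_surface_snd ht hz).mul hrt)).mul
      ((hu.norm_sq ℝ).const_mul (1 / 2)))

/-- The local energy balance in the parameter cell. -/
theorem IsSolution.local_energy_balance (hsol : IsSolution p J ρ u P) (hJ : IsOpen J) {t : ℝ}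
    (ht : t ∈ J) {z : ℝ × ℝ} (hz : z ∈ cell p) :
    fderiv ℝ (radialFlux p ρ u P t) z (1, 0) + fderiv ℝ (angularFlux p ρ u P t) z (0, 1)
      = -(kineticDeriv ρ u t z + p.visc / 2 * (z.1 * ρ t z.2 ^ 2 *
        symGradSq (regularPart p (ρ t)) (u t) (scaledPolar (ρ t) z))) := by
  have h := hsol.regularity
  obtain ⟨s, θ⟩ := z
  have hx := h.scaledPolar_mem_fluidDomain ht hz
  obtain ⟨hF, hdiv⟩ := hsol.divVec_flux hJ ht hx
  have hρ := hasDerivAt_of_differentiableOn p (h.ρ_diff t ht) hz.2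
  have a1 := (hsol.differentiableAt_angularFlux hJ ht hz).hasFDerivAt.comp_hasDerivAt θ
    ((hasDerivAt_const θ s).prodMk (hasDerivAt_id θ))
  have a2 := hasDerivAt_angular_component hρ hF
  have a3 := a1.unique a2
  have r1 := (hsol.differentiableAt_radialFlux hJ ht hz).hasFDerivAt.comp_hasDerivAt s
    ((hasDerivAt_id s).prodMk (hasDerivAt_const s θ))
  have hu := ((h.differentiableAt_velocity ht hx).hasFDerivAt.comp_hasDerivAt s
    (hasDerivAt_scaledPolar_radial (ρ t) s θ)).norm_sq
  have r2 := (hasDerivAt_radial_component (n := normalN p (ρ t) θ) hF).sub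
    ((((hasDerivAt_id s).pow 2).mul_const (ρ t θ * deriv (fun s => ρ s θ) t)).mul
      (hu.const_mul (1 / 2)))
  have r3 := r1.unique r2
  rw [r3, a3]
  have hp := piola_identity (fderiv ℝ (flux p.visc (regularPart p (ρ t)) (P t) (u t))
    (scaledPolar (ρ t) (s, θ))) (flux p.visc (regularPart p (ρ t)) (P t) (u t)
    (scaledPolar (ρ t) (s, θ))) s (ρ t θ) (dTheta p (ρ t) θ) θ
  rw [divVec] at hdiv
  rw [hdiv] at hp
  simp only [normalN, kineticDeriv] at hp ⊢
  simp only [inner_add_right, map_smul, inner_smul_right, Function.comp, Pi.pow_apply, id] at hp ⊢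
  push_cast
  linear_combination hp

end Kinetic

section Balance

variable {p : Params} {J : Set ℝ} {ρ : ℝ → ℝ → ℝ} {u : ℝ → Plane → Plane} {P : ℝ → Plane → ℝ}

/-! ### Boundary values of the energy flux -/

lemma inner_act_comm {M : Matrix (Fin 2) (Fin 2) ℝ} (hM : ∀ i j, M i j = M j i) (v n : Plane) :
    inner ℝ (act M v) n = inner ℝ (act M n) v := by
  simp only [plane_inner, act_apply, hM 1 0]
  ring

lemma act_smul (M : Matrix (Fin 2) (Fin 2) ℝ) (c : ℝ) (n : Plane) :
    act M (c • n) = c • act M n := by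
  refine plane_ext ?_ ?_ <;> simp only [act_apply, PiLp.smul_apply, smul_eq_mul] <;> ring

lemma inner_polar_frame (x y : Plane) (θ : ℝ) :
    inner ℝ x y = inner ℝ x (eR θ) * inner ℝ y (eR θ)
      + inner ℝ x (ePhi θ) * inner ℝ y (ePhi θ) := by
  simp only [plane_inner, eR_zero, eR_one, ePhi_zero, ePhi_one]
  linear_combination (-(x 0 * y 0 + x 1 * y 1)) * cos_sq_add_sin_sq θ

lemma inner_normalN_self (p : Params) (ρ : ℝ → ℝ) (θ : ℝ) :
    inner ℝ (normalN p ρ θ) (normalN p ρ θ) = arcDensity p ρ θ ^ 2 := by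
  rw [arcDensity, sq_sqrt (by positivity)]
  simp only [normalN, plane_inner, PiLp.sub_apply, PiLp.smul_apply, eR_zero, eR_one, ePhi_zero,
    ePhi_one, smul_eq_mul]
  linear_combination (ρ θ ^ 2 + dTheta p ρ θ ^ 2) * cos_sq_add_sin_sq θ

lemma IsSolution.act_stress_normalN (hsol : IsSolution p J ρ u P) {t θ : ℝ} (ht : t ∈ J)
    (hθ : θ ∈ Ioo p.lo p.hi) :
    act (stress p.visc (regularPart p (ρ t)) (P t) (u t) (ρ t θ • eR θ)) (normalN p (ρ t) θ)
      = normalStress p (ρ t) θ • normalN p (ρ t) θ := by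
  have ha := arcDensity_pos (p := p) (hsol.regularity.ρ_pos t ht θ (Ioo_subset_Icc_self hθ))
  have h := congrArg (fun w => arcDensity p (ρ t) θ • w) (hsol.dynamic t ht θ hθ)
  simp only [unitNormal, act_smul] at h
  rw [smul_comm _ (p.g * ρ t θ * sin θ - p.σ * meanCurv p (ρ t) θ), smul_smul,
    smul_smul (arcDensity p (ρ t) θ), mul_one_div_cancel ha.ne', one_smul, one_smul] at h
  exact h

lemma scaledPolar_one (ρ : ℝ → ℝ) (θ : ℝ) : scaledPolar ρ (1, θ) = ρ θ • eR θ := by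
  simp [scaledPolar]

lemma IsSolution.radialFlux_one (hsol : IsSolution p J ρ u P) {t θ : ℝ} (ht : t ∈ J)
    (hθ : θ ∈ Ioo p.lo p.hi) :
    radialFlux p ρ u P t (1, θ)
      = normalStress p (ρ t) θ * (ρ t θ * deriv (fun s => ρ s θ) t) := by
  have hθ' := Ioo_subset_Icc_self hθ
  have hk : inner ℝ (u t (ρ t θ • eR θ)) (normalN p (ρ t) θ)
      = ρ t θ * deriv (fun s => ρ s θ) t := by
    rw [hsol.kinematic t ht θ hθ', ← mul_assoc,
      mul_one_div_cancel (hsol.regularity.ρ_pos t ht θ hθ').ne', one_mul]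
  simp only [radialFlux, scaledPolar_one, flux]
  rw [inner_add_left, inner_act_comm (stress_symm _ _ _ _ _), hsol.act_stress_normalN ht hθ,
    real_inner_smul_left, real_inner_smul_left, real_inner_comm, hk]
  ring

lemma inner_flux_ePhi {visc : ℝ} {D : Set Plane} {q : Plane → ℝ} {v : Plane → Plane} {x : Plane}
    {θ : ℝ} (hv : inner ℝ (v x) (ePhi θ) = 0) :
    inner ℝ (flux visc D q v x) (ePhi θ)
      = inner ℝ (act (stress visc D q v x) (ePhi θ)) (eR θ) * inner ℝ (v x) (eR θ) := by
  rw [flux, inner_add_left, inner_act_comm (stress_symm _ _ _ _ _), real_inner_smul_left, hv,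
    inner_polar_frame _ _ θ, hv]
  ring

lemma norm_sq_of_inner_ePhi {v : Plane} {θ : ℝ} (hv : inner ℝ v (ePhi θ) = 0) :
    ‖v‖ ^ 2 = inner ℝ v (eR θ) ^ 2 := by
  rw [← real_inner_self_eq_norm_sq, inner_polar_frame _ _ θ, hv]
  ring

lemma Regularity.wall_radius_mem (h : Regularity p J ρ u P) {t s θ : ℝ} (ht : t ∈ J)
    (hs : s ∈ Ioo (0 : ℝ) 1) (hθ : θ ∈ Icc p.lo p.hi) : s * ρ t θ ∈ Ioo 0 (ρ t θ) :=
  ⟨mul_pos hs.1 (h.ρ_pos t ht θ hθ), mul_lt_of_lt_one_left (h.ρ_pos t ht θ hθ) hs.2⟩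

lemma IsSolution.angularFlux_hi (hsol : IsSolution p J ρ u P) {t s : ℝ} (ht : t ∈ J)
    (hs : s ∈ Ioo (0 : ℝ) 1) :
    angularFlux p ρ u P t (s, p.hi)
      = ρ t p.hi * (p.β * ‖u t ((s * ρ t p.hi) • eR p.hi)‖ ^ 2) := by
  have hr := hsol.regularity.wall_radius_mem ht hs (right_mem_Icc.2 p.lo_lt_hi.le)
  have hv := hsol.nonpenetration_hi t ht _ hr
  have hsl := hsol.slip_hi t ht _ hr
  rw [inner_sub_left, real_inner_smul_left] at hsl
  simp only [angularFlux, scaledPolar]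
  rw [inner_flux_ePhi hv, norm_sq_of_inner_ePhi hv, sub_eq_zero.1 hsl]
  ring

lemma IsSolution.angularFlux_lo (hsol : IsSolution p J ρ u P) {t s : ℝ} (ht : t ∈ J)
    (hs : s ∈ Ioo (0 : ℝ) 1) :
    angularFlux p ρ u P t (s, p.lo)
      = -(ρ t p.lo * (p.β * ‖u t ((s * ρ t p.lo) • eR p.lo)‖ ^ 2)) := by
  have hr := hsol.regularity.wall_radius_mem ht hs (left_mem_Icc.2 p.lo_lt_hi.le)
  have hv := hsol.nonpenetration_lo t ht _ hr
  rw [inner_neg_right, neg_eq_zero] at hv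
  have hsl := hsol.slip_lo t ht _ hr
  rw [inner_sub_left, real_inner_smul_left, ← neg_one_smul ℝ, act_smul, real_inner_smul_left] at hsl
  simp only [angularFlux, scaledPolar]
  rw [inner_flux_ePhi hv, norm_sq_of_inner_ePhi hv]
  linear_combination (-(ρ t p.lo * inner ℝ (u t ((s * ρ t p.lo) • eR p.lo)) (eR p.lo))) * hsl

lemma tendsto_fst_one {f : ℝ × ℝ → ℝ} (hf : ContinuousOn f (edgeCell p)) {θ : ℝ}
    (hθ : θ ∈ Ioo p.lo p.hi) : Tendsto (fun s => f (s, θ)) (𝓝[<] 1) (𝓝 (f (1, θ))) := by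
  have h1 : (1, θ) ∈ edgeCell p :=
    ⟨⟨right_mem_Icc.2 zero_le_one, Ioo_subset_Icc_self hθ⟩, one_pos, Or.inr hθ⟩
  refine (hf _ h1).tendsto.comp (tendsto_nhdsWithin_iff.2 ⟨?_, ?_⟩)
  · exact ((Continuous.prodMk_left θ).tendsto 1).mono_left nhdsWithin_le_nhds
  · filter_upwards [Ioo_mem_nhdsLT (zero_lt_one' ℝ)] with s hs
    exact cell_subset_edgeCell p ⟨hs, hθ⟩

lemma tendsto_snd_lo {f : ℝ × ℝ → ℝ} (hf : ContinuousOn f (edgeCell p)) {s : ℝ}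
    (hs : s ∈ Ioo (0 : ℝ) 1) : Tendsto (fun θ => f (s, θ)) (𝓝[>] p.lo) (𝓝 (f (s, p.lo))) := by
  have h1 : (s, p.lo) ∈ edgeCell p :=
    ⟨⟨Ioo_subset_Icc_self hs, left_mem_Icc.2 p.lo_lt_hi.le⟩, hs.1, Or.inl hs.2⟩
  refine (hf _ h1).tendsto.comp (tendsto_nhdsWithin_iff.2 ⟨?_, ?_⟩)
  · exact ((Continuous.prodMk_right s).tendsto p.lo).mono_left nhdsWithin_le_nhds
  · filter_upwards [Ioo_mem_nhdsGT p.lo_lt_hi] with θ hθ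
    exact cell_subset_edgeCell p ⟨hs, hθ⟩

lemma tendsto_snd_hi {f : ℝ × ℝ → ℝ} (hf : ContinuousOn f (edgeCell p)) {s : ℝ}
    (hs : s ∈ Ioo (0 : ℝ) 1) : Tendsto (fun θ => f (s, θ)) (𝓝[<] p.hi) (𝓝 (f (s, p.hi))) := by
  have h1 : (s, p.hi) ∈ edgeCell p :=
    ⟨⟨Ioo_subset_Icc_self hs, right_mem_Icc.2 p.lo_lt_hi.le⟩, hs.1, Or.inl hs.2⟩
  refine (hf _ h1).tendsto.comp (tendsto_nhdsWithin_iff.2 ⟨?_, ?_⟩)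
  · exact ((Continuous.prodMk_right s).tendsto p.hi).mono_left nhdsWithin_le_nhds
  · filter_upwards [Ioo_mem_nhdsLT p.lo_lt_hi] with θ hθ
    exact cell_subset_edgeCell p ⟨hs, hθ⟩

lemma Regularity.continuousOn_normalN_edgeCell (h : Regularity p J ρ u P) {t : ℝ} (ht : t ∈ J) :
    ContinuousOn (fun z : ℝ × ℝ => normalN p (ρ t) z.2) (edgeCell p) :=
  (h.continuousOn_normalN ht).comp continuous_snd.continuousOn fun _ hz => hz.1.2

lemma Regularity.continuousOn_angularFlux (h : Regularity p J ρ u P) (hJ : IsOpen J) {t : ℝ}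
    (ht : t ∈ J) : ContinuousOn (angularFlux p ρ u P t) (edgeCell p) :=
  ((h.continuousOn_surface_cell ht).mono fun _ hz => hz.1).mul
    ((h.continuousOn_flux hJ ht).inner (continuous_ePhi.comp continuous_snd).continuousOn)

lemma Regularity.continuousOn_radialFlux (h : Regularity p J ρ u P) (hJ : IsOpen J) {t : ℝ}
    (ht : t ∈ J) : ContinuousOn (radialFlux p ρ u P t) (edgeCell p) := by
  have hsub : edgeCell p ⊆ Icc (0 : ℝ) 1 ×ˢ Icc p.lo p.hi := fun _ hz => hz.1
  exact (continuous_fst.continuousOn.mul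
    ((h.continuousOn_flux hJ ht).inner (h.continuousOn_normalN_edgeCell ht))).sub
    (((continuous_fst.pow 2).continuousOn.mul (((h.continuousOn_surface_cell ht).mono hsub).mul
      ((h.continuousOn_time_deriv_cell ht).mono hsub))).mul
      (continuousOn_const.mul (((h.continuousOn_velocity ht).mono hsub).norm.pow 2)))

/-- The normal stress of the free surface is integrable up to the contact points. -/
lemma IsSolution.integrableOn_normalStress (hsol : IsSolution p J ρ u P) (hJ : IsOpen J) {t : ℝ}
    (ht : t ∈ J) : IntegrableOn (normalStress p (ρ t)) (Ioo p.lo p.hi) := by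
  have h := hsol.regularity
  obtain ⟨δ, m, M, C, e, hb, hg⟩ := h.exists_cellGrowth hJ ht
  have htb : t ∈ Metric.closedBall t δ := Metric.mem_closedBall_self hb.δ_pos.le
  let Q : ℝ × ℝ → ℝ := fun z => inner ℝ (act (stress p.visc (regularPart p (ρ t)) (P t) (u t)
    (scaledPolar (ρ t) z)) (normalN p (ρ t) z.2)) (normalN p (ρ t) z.2) / arcDensity p (ρ t) z.2 ^ 2
  have hapos : ∀ θ ∈ Icc p.lo p.hi, 0 < arcDensity p (ρ t) θ := fun θ hθ =>
    arcDensity_pos (h.ρ_pos t ht θ hθ)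
  have ca : ContinuousOn (arcDensity p (ρ t)) (Icc p.lo p.hi) :=
    continuousOn_slab_slice (f := fun τ => arcDensity p (ρ τ)) h.continuousOn_arcDensity ht
  have hQ : ContinuousOn Q (edgeCell p) :=
    ((h.continuousOn_act_stress hJ ht subset_rfl (h.continuousOn_normalN_edgeCell ht)).inner
      (h.continuousOn_normalN_edgeCell ht)).div
      ((ca.comp continuous_snd.continuousOn fun _ hz => hz.1.2).pow 2)
      fun z hz => (pow_pos (hapos _ hz.1.2) 2).ne'
  have hval : ∀ θ ∈ Ioo p.lo p.hi, Q (1, θ) = normalStress p (ρ t) θ := by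
    intro θ hθ
    simp only [Q, scaledPolar_one]
    rw [hsol.act_stress_normalN ht hθ, real_inner_smul_left, inner_normalN_self,
      mul_div_cancel_right₀ _ (pow_pos (hapos _ (Ioo_subset_Icc_self hθ)) 2).ne']
  have hμ := p.visc_pos
  set c := 4 * (1 + 2 * p.visc) with hc
  have hcp : 0 < c := by positivity
  have hQle : ∀ z ∈ cell p, |Q z| ≤ c * (C * (z.1 ^ e + angleWeight p e z.2)) := by
    intro z hz
    have hzθ := Ioo_subset_Icc_self hz.2
    have ha := hapos _ hzθ
    have hN : ‖normalN p (ρ t) z.2‖ ^ 2 = arcDensity p (ρ t) z.2 ^ 2 := by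
      rw [← real_inner_self_eq_norm_sq, inner_normalN_self]
    have h1 := (abs_real_inner_le_norm _ _).trans (mul_le_mul_of_nonneg_right
      (h.norm_act_stress_le hJ ht hz (normalN p (ρ t) z.2)) (norm_nonneg (normalN p (ρ t) z.2)))
    simp only [Q]
    rw [abs_div, abs_of_pos (pow_pos ha 2), div_le_iff₀ (pow_pos ha 2)]
    refine h1.trans ?_
    rw [mul_assoc, ← pow_two, hN]
    refine mul_le_mul_of_nonneg_right ?_ (by positivity)
    rw [← mul_assoc]
    exact mul_le_mul_of_nonneg_left (hg.angle t htb z hz) hcp.le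
  have hle : ∀ θ ∈ Ioo p.lo p.hi, |normalStress p (ρ t) θ| ≤ c * (C * (1 + angleWeight p e θ)) := by
    intro θ hθ
    rw [← hval θ hθ]
    have hlim : Tendsto (fun s : ℝ => c * (C * (s ^ e + angleWeight p e θ))) (𝓝[<] 1)
        (𝓝 (c * (C * (1 ^ e + angleWeight p e θ)))) := by
      have : ContinuousAt (fun s : ℝ => s ^ e) 1 :=
        continuousAt_rpow_const _ _ (Or.inl one_ne_zero)
      exact (((this.tendsto.mono_left nhdsWithin_le_nhds).add_const _).const_mul C).const_mul c
    rw [one_rpow] at hlim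
    refine le_of_tendsto_of_tendsto (tendsto_fst_one hQ hθ).abs hlim ?_
    filter_upwards [Ioo_mem_nhdsLT (zero_lt_one' ℝ)] with s hs using hQle (s, θ) ⟨hs, hθ⟩
  have hcont : ContinuousOn (normalStress p (ρ t)) (Ioo p.lo p.hi) := by
    refine ContinuousOn.congr (hQ.comp (Continuous.prodMk_right (1 : ℝ)).continuousOn ?_)
      fun θ hθ => (hval θ hθ).symm
    exact fun θ hθ => ⟨⟨right_mem_Icc.2 zero_le_one, Ioo_subset_Icc_self hθ⟩, one_pos, Or.inr hθ⟩
  have hdom : IntegrableOn (fun θ => c * (C * (1 + angleWeight p e θ))) (Ioo p.lo p.hi) :=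
    ((((integrableOn_const (by simp)).add
      (integrableOn_angleWeight p hg.lt_e)).const_mul C).const_mul c)
  exact Integrable.mono' hdom (hcont.aestronglyMeasurable measurableSet_Ioo)
    ((ae_restrict_iff' measurableSet_Ioo).2 (ae_of_all _ hle))

/-- The kinetic energy balance, integrated over the parameter cell. -/
theorem IsSolution.integral_energy_balance (hsol : IsSolution p J ρ u P) (hJ : IsOpen J) {t : ℝ}
    (ht : t ∈ J) :
    (∫ z in cell p, kineticDeriv ρ u t z)
      + p.visc / 2 * (∫ z in cell p, z.1 * ρ t z.2 ^ 2 *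
        symGradSq (regularPart p (ρ t)) (u t) (scaledPolar (ρ t) z))
      + slipDissipation p (ρ t) (u t)
      + (∫ θ in p.lo..p.hi, normalStress p (ρ t) θ * (ρ t θ * deriv (fun s => ρ s θ) t)) = 0 := by
  have h := hsol.regularity
  obtain ⟨δ, m, M, C, e, hb, hg⟩ := h.exists_cellGrowth hJ ht
  obtain ⟨U, hU0, hU⟩ := h.exists_velocity_bound hb.ball
  have htb : t ∈ Metric.closedBall t δ := Metric.mem_closedBall_self hb.δ_pos.le
  have hμ := p.visc_pos
  have hk := (h.hasDerivAt_integral_kinetic hJ ht).1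
  have hd := (h.integrableOn_symGradSq hJ ht).const_mul (p.visc / 2)
  have hm := (isOpen_cell p).measurableSet
  have hM0 : 0 ≤ M := (abs_nonneg _).trans (hb.dTheta_le t htb p.lo (left_mem_Icc.2 p.lo_lt_hi.le))
  have hbal := fun z (hz : z ∈ cell p) => hsol.local_energy_balance hJ ht hz
  set c := 4 * (1 + 2 * p.visc) * U with hc
  have hc0 : 0 ≤ c := by positivity
  have hF : ∀ z ∈ cell p, ‖flux p.visc (regularPart p (ρ t)) (P t) (u t) (scaledPolar (ρ t) z)‖
      ≤ c * growthQuantity u P t (scaledPolar (ρ t) z) + U ^ 3 := fun z hz =>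
    h.norm_flux_le hJ ht hz (hU t htb z (cell_subset_Icc p hz))
  have hN : ∀ θ ∈ Icc p.lo p.hi, ‖normalN p (ρ t) θ‖ ≤ 2 * M := by
    intro θ hθ
    refine (norm_sub_le _ _).trans ?_
    rw [norm_smul, norm_smul, norm_eR, norm_ePhi, norm_eq_abs, norm_eq_abs,
      abs_of_pos (h.ρ_pos t ht θ hθ)]
    linarith [hb.upper t htb θ hθ, hb.dTheta_le t htb θ hθ]
  have hradial : ∀ z ∈ cell p, |radialFlux p ρ u P t z|
      ≤ (z.1 * (c * growthQuantity u P t (scaledPolar (ρ t) z) + U ^ 3)) * (2 * M)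
        + z.1 * (M * M * U ^ 2) := by
    intro z hz
    have hzθ := Ioo_subset_Icc_self hz.2
    have h0 : 0 < z.1 := hz.1.1
    have h1 : z.1 ≤ 1 := hz.1.2.le
    have hρ0 := h.ρ_pos t ht _ hzθ
    have hG := growthQuantity_nonneg u P t (scaledPolar (ρ t) z)
    refine (abs_sub _ _).trans (add_le_add ?_ ?_)
    · rw [abs_mul, abs_of_pos h0, mul_assoc]
      refine mul_le_mul_of_nonneg_left ((abs_real_inner_le_norm _ _).trans ?_) h0.le
      exact mul_le_mul (hF z hz) (hN _ hzθ) (norm_nonneg _) (by positivity)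
    · rw [abs_mul, abs_mul, abs_mul, abs_of_nonneg (sq_nonneg z.1), abs_of_pos hρ0,
        abs_of_nonneg (by positivity : 0 ≤ 1 / 2 * ‖u t (scaledPolar (ρ t) z)‖ ^ 2)]
      have hr := hb.upper t htb _ hzθ
      have hrt := hb.deriv_le t htb _ hzθ
      have hu := hU t htb z (cell_subset_Icc p hz)
      have h2 : z.1 ^ 2 ≤ z.1 := by nlinarith
      calc _ ≤ z.1 * (M * M) * (1 * U ^ 2) := by gcongr; norm_num
        _ = _ := by ring
  have hradial' : ∀ z ∈ cell p, |radialFlux p ρ u P t z|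
      ≤ (c * (C * (1 + angleWeight p e z.2)) + U ^ 3) * (2 * M) + M * M * U ^ 2 := by
    intro z hz
    have h0 : 0 < z.1 := hz.1.1
    have h1 : z.1 ≤ 1 := hz.1.2.le
    refine (hradial z hz).trans (add_le_add (mul_le_mul_of_nonneg_right ?_ (by positivity)) ?_)
    · have := mul_le_mul_of_nonneg_left (hg.mul_le htb hz) hc0
      have h3 : z.1 * U ^ 3 ≤ U ^ 3 := mul_le_of_le_one_left (by positivity) h1
      linarith
    · exact mul_le_of_le_one_left (by positivity) h1
  have hangular : ∀ z ∈ cell p, |angularFlux p ρ u P t z|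
      ≤ M * (c * (C * (z.1 ^ e + (1 - z.1) ^ e)) + U ^ 3) := by
    intro z hz
    have hzθ := Ioo_subset_Icc_self hz.2
    have hρ0 := h.ρ_pos t ht _ hzθ
    rw [angularFlux, abs_mul, abs_of_pos hρ0]
    refine mul_le_mul (hb.upper t htb _ hzθ) ((abs_real_inner_le_norm _ _).trans ?_)
      (abs_nonneg _) hM0
    rw [norm_ePhi, mul_one]
    refine (hF z hz).trans ?_
    gcongr
    exact hg.radial t htb z hz
  have hzero : ∀ θ ∈ Ioo p.lo p.hi,
      Tendsto (fun s => radialFlux p ρ u P t (s, θ)) (𝓝[>] 0) (𝓝 0) := by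
    intro θ hθ
    have hpow : Tendsto (fun s : ℝ => s ^ (1 + e)) (𝓝[>] 0) (𝓝 0) := by
      have h1e : 0 < 1 + e := by linarith [hg.lt_e]
      have : ContinuousAt (fun s : ℝ => s ^ (1 + e)) 0 :=
        continuousAt_rpow_const _ _ (Or.inr h1e.le)
      have h2 := this.tendsto.mono_left (nhdsWithin_le_nhds (s := Ioi 0))
      rwa [zero_rpow h1e.ne'] at h2
    have hid : Tendsto (fun s : ℝ => s) (𝓝[>] 0) (𝓝 0) := nhdsWithin_le_nhds
    have hmaj : Tendsto (fun s : ℝ => (c * (C * (s ^ (1 + e) + s * angleWeight p e θ)) + s * U ^ 3)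
        * (2 * M) + s * (M * M * U ^ 2)) (𝓝[>] 0) (𝓝 0) := by
      have := ((((hpow.add (hid.mul_const (angleWeight p e θ))).const_mul C).const_mul c).add
        (hid.mul_const (U ^ 3))).mul_const (2 * M) |>.add (hid.mul_const (M * M * U ^ 2))
      simpa using this
    refine squeeze_zero_norm' ?_ hmaj
    filter_upwards [Ioo_mem_nhdsGT (zero_lt_one' ℝ)] with s hs
    refine (hradial (s, θ) ⟨hs, hθ⟩).trans ?_
    have hs0 : 0 < s := hs.1
    have hang := mul_le_mul_of_nonneg_left (hg.angle t htb (s, θ) ⟨hs, hθ⟩) hs0.le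
    have hang' := mul_le_mul_of_nonneg_left hang hc0
    simp only at hang' ⊢
    rw [rpow_add hs0, rpow_one]
    gcongr
    linarith
  have hkk : IntegrableOn (fun θ => (c * (C * (1 + angleWeight p e θ)) + U ^ 3) * (2 * M)
      + M * M * U ^ 2) (Ioo p.lo p.hi) :=
    ((((((integrableOn_const (by simp)).add (integrableOn_angleWeight p hg.lt_e)).const_mul
      C).const_mul c).add (integrableOn_const (by simp))).mul_const (2 * M)).add
      (integrableOn_const (by simp))
  have hhh : IntegrableOn (fun s : ℝ => M * (c * (C * (s ^ e + (1 - s) ^ e)) + U ^ 3))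
      (Ioo 0 1) :=
    ((((((integrableOn_rpow_Ioo hg.lt_e).add (integrableOn_one_sub_rpow_Ioo hg.lt_e)).const_mul
      C).const_mul c).add (integrableOn_const (by simp))).const_mul M)
  have hdivint : IntegrableOn (fun z => fderiv ℝ (radialFlux p ρ u P t) z (1, 0)
      + fderiv ℝ (angularFlux p ρ u P t) z (0, 1)) (cell p) :=
    IntegrableOn.congr_fun (hk.add hd).neg (fun z hz => (hbal z hz).symm) hm
  have hdiv := integral_divergence_Ioo_prod zero_lt_one p.lo_lt_hi
    (fun z hz => (hsol.differentiableAt_radialFlux hJ ht hz).hasFDerivAt)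
    (fun z hz => (hsol.differentiableAt_angularFlux hJ ht hz).hasFDerivAt)
    hdivint hkk hradial' hhh hangular hzero
    (fun θ hθ => tendsto_fst_one (h.continuousOn_radialFlux hJ ht) hθ)
    (fun s hs => tendsto_snd_lo (h.continuousOn_angularFlux hJ ht) hs)
    (fun s hs => tendsto_snd_hi (h.continuousOn_angularFlux hJ ht) hs)
  have hlhs : ∫ z in cell p, (fderiv ℝ (radialFlux p ρ u P t) z (1, 0)
      + fderiv ℝ (angularFlux p ρ u P t) z (0, 1))
      = -((∫ z in cell p, kineticDeriv ρ u t z)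
      + p.visc / 2 * (∫ z in cell p, z.1 * ρ t z.2 ^ 2 *
        symGradSq (regularPart p (ρ t)) (u t) (scaledPolar (ρ t) z))) := by
    rw [setIntegral_congr_fun hm hbal, integral_neg, integral_add hk hd, integral_const_mul]
  have hsurf : ∫ θ in p.lo..p.hi, radialFlux p ρ u P t (1, θ)
      = ∫ θ in p.lo..p.hi, normalStress p (ρ t) θ * (ρ t θ * deriv (fun s => ρ s θ) t) := by
    rw [intervalIntegral.integral_of_le p.lo_lt_hi.le, intervalIntegral.integral_of_le p.lo_lt_hi.le,
      integral_Ioc_eq_integral_Ioo, integral_Ioc_eq_integral_Ioo]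
    exact setIntegral_congr_fun measurableSet_Ioo fun θ hθ => hsol.radialFlux_one ht hθ
  have hwall : ∀ θ, ∫ s in (0 : ℝ)..1, ρ t θ * (p.β * ‖u t ((s * ρ t θ) • eR θ)‖ ^ 2)
      = ∫ r in (0 : ℝ)..(ρ t θ), p.β * ‖u t (r • eR θ)‖ ^ 2 := by
    intro θ
    have := intervalIntegral.smul_integral_comp_mul_right (a := 0) (b := 1)
      (fun r => p.β * ‖u t (r • eR θ)‖ ^ 2) (ρ t θ)
    rw [zero_mul, one_mul, smul_eq_mul] at this
    rw [← this, intervalIntegral.integral_const_mul]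
  have hhi : ∫ s in (0 : ℝ)..1, angularFlux p ρ u P t (s, p.hi)
      = ∫ r in (0 : ℝ)..(ρ t p.hi), p.β * ‖u t (r • eR p.hi)‖ ^ 2 := by
    rw [← hwall, intervalIntegral.integral_of_le zero_le_one,
      intervalIntegral.integral_of_le zero_le_one,
      integral_Ioc_eq_integral_Ioo, integral_Ioc_eq_integral_Ioo]
    exact setIntegral_congr_fun measurableSet_Ioo fun s hs => hsol.angularFlux_hi ht hs
  have hlo : ∫ s in (0 : ℝ)..1, angularFlux p ρ u P t (s, p.lo)
      = -∫ r in (0 : ℝ)..(ρ t p.lo), p.β * ‖u t (r • eR p.lo)‖ ^ 2 := by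
    rw [← hwall, ← intervalIntegral.integral_neg, intervalIntegral.integral_of_le zero_le_one,
      intervalIntegral.integral_of_le zero_le_one,
      integral_Ioc_eq_integral_Ioo, integral_Ioc_eq_integral_Ioo]
    exact setIntegral_congr_fun measurableSet_Ioo fun s hs => hsol.angularFlux_lo ht hs
  rw [← cell, hlhs, hsurf, hhi, hlo, intervalIntegral.integral_zero] at hdiv
  rw [slipDissipation]
  linarith

end Balance

end Droplet

end

theorem mainTheorem5 (p : Droplet.Params) (J : Set ℝ) (hJ : IsOpen J)
    (ρ : ℝ → ℝ → ℝ) (u : ℝ → Droplet.Plane → Droplet.Plane) (P : ℝ → Droplet.Plane → ℝ)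
    (hsol : Droplet.IsSolution p J ρ u P) (t : ℝ) (ht : t ∈ J) :
    IntegrableOn (fun x => ‖u t x‖ ^ 2) (Droplet.fluidDomain p (ρ t)) ∧
    IntegrableOn (Droplet.symGradSq (Droplet.regularPart p (ρ t)) (u t))
      (Droplet.fluidDomain p (ρ t)) ∧
    DifferentiableAt ℝ (Droplet.totalEnergy p ρ u) t ∧
    deriv (Droplet.totalEnergy p ρ u) t
      + Droplet.viscousDissipation p (ρ t) (u t)
      + Droplet.slipDissipation p (ρ t) (u t)
      + deriv (Droplet.leftContact p ρ) t * p.W (deriv (Droplet.leftContact p ρ) t)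
      + deriv (Droplet.rightContact p ρ) t * p.W (deriv (Droplet.rightContact p ρ) t) = 0 := by
  have h := hsol.regularity
  have cv := fun τ (hτ : τ ∈ J) =>
    Droplet.fluidDomain_change_of_variables p (h.ρ_diff τ hτ) (h.ρ_pos τ hτ)
  have hE : HasDerivAt (Droplet.totalEnergy p ρ u) _ t :=
    ((h.hasDerivAt_integral_kinetic hJ ht).2.add (hsol.hasDerivAt_surfaceEnergy hJ ht
      (hsol.integrableOn_normalStress hJ ht))).congr_of_eventuallyEq <| by
      filter_upwards [hJ.mem_nhds ht] with τ hτ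
      simp only [Droplet.totalEnergy, (cv τ hτ _).1, Droplet.kinetic, Pi.add_apply]
  refine ⟨?_, ?_, hE.differentiableAt, ?_⟩
  · rw [(cv t ht _).2]
    have h2 := (h.integrableOn_kinetic ht).const_mul 2
    refine h2.congr (ae_of_all _ fun z => ?_)
    simp only [Droplet.kinetic]
    ring
  · rw [(cv t ht _).2]
    exact h.integrableOn_symGradSq hJ ht
  · have hb := hsol.integral_energy_balance hJ ht
    have hv : Droplet.viscousDissipation p (ρ t) (u t)
        = p.visc / 2 * ∫ z in Droplet.cell p, z.1 * ρ t z.2 ^ 2 *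
          Droplet.symGradSq (Droplet.regularPart p (ρ t)) (u t)
            (Droplet.scaledPolar (ρ t) z) := by
      rw [Droplet.viscousDissipation, integral_const_mul, (cv t ht _).1]
    rw [hE.deriv, hv]
    change _ + deriv (fun s => ρ s p.hi) t * p.W (deriv (fun s => ρ s p.hi) t)
      + deriv (fun s => ρ s p.lo) t * p.W (deriv (fun s => ρ s p.lo) t) = 0
    linarith
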